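/- Let $\mathbb H^3_1=\{(z_1,z_2)\in\mathbb C^2 : |z_1|^2-|z_2|^2=1\}$, identified with $SU(1,1)$ by $(z_1,z_2)\mapsto Z=\begin{pmatrix} z_1&z_2\\ \bar z_2&\bar z_1\end{pmatrix}$, with base point $o=(1,0)$. Let $X_0,X_1,X_2$ be the left-invariant vector fields on $\mathbb H^3_1$ given by $\begin{pmatrix} i&0\\0&-i\end{pmatrix},\begin{pmatrix}0&1\\1&0\end{pmatrix},\begin{pmatrix}0&i\\-i&0\end{pmatrix}\in\mathfrak{su}(1,1)$, let $\theta^0,\theta^1,\theta^2$ be the dual frame, and for real $\lambda\neq0$, $\mu,\nu>0$ put $g_{\lambda\mu\nu}=\lambda\,\theta^0\otimes\theta^0+\mu\,\theta^1\otimes\theta^1+\nu\,\theta^2\otimes\theta^2$, with Levi-Civita connection $\nabla$ and curvature $R$. For $t\in\mathbb R$ let $S=S_\lambda(t)$ be the tensor field of type $(1,2)$ defined by $$g_{\lambda\mu\nu}(S_XY,Z)=\bigl(-\lambda\,\theta^2\otimes(\theta^0\wedge\theta^1)+t\,\theta^0\otimes(\theta^1\wedge\theta^2)-\lambda\,\theta^1\otimes(\theta^2\wedge\theta^0)\bigr)(X,Y,Z),$$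 where $\alpha\wedge\beta=\alpha\otimes\beta-\beta\otimes\alpha$, and put $\widetilde\nabla=\nabla-S$, with curvature $\widetilde R$. Let a Lie group $G$ with Lie algebra $\mathfrak g$ act transitively on $\mathbb H^3_1$ by isometries, with isotropy group $H$ at $o$, and let $B^*$ denote the vector field generated by the flow $\exp(sB)$, $B\in\mathfrak g$. A decomposition $\mathfrak g=\mathfrak m\oplus\mathfrak h$ is reductive if $\mathfrak h$ is the Lie algebra of $H$ and $\mathrm{Ad}(H)\mathfrak m\subset\mathfrak m$. We say that it induces and is induced by $S$ if (i) $\widetilde\nabla$ is its canonical connection, i.e. the $G$-invariant connection with $\widetilde\nabla_{B^*}C^*|_o=-([B,C]_{\mathfrak m})^*|_o$ for $B,C\in\mathfrak m$; and (ii) $\mathfrak g=\mathfrak m\oplus\mathfrak h$ is isomorphic to $T_o\mathbb H^3_1\oplus\widetilde{\mathfrak h}$, where $\widetilde{\mathfrak h}\subset\mathrm{End}(T_o\mathbb H^3_1)$ is the Lie algebra generated by all $\widetilde R(x,y)$ at $o$, with bracket $[U,V]=UV-VU$, $[U,x]=U(x)$, $[x,y]=S_xy-S_yx-\widetilde R(x,y)$,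 by a Lie algebra isomorphism that maps $\mathfrak h$ onto $\widetilde{\mathfrak h}$ and is $B\mapsto B^*|_o$ on $\mathfrak m$. **Theorem.** Assume $-\lambda\neq\mu=\nu$. Then $S=S_\lambda(t)$ is a homogeneous pseudo-Riemannian structure on $(\mathbb H^3_1,g_{\lambda\mu\nu})$, i.e. $\widetilde\nabla g_{\lambda\mu\nu}=0$, $\widetilde\nabla R=0$, $\widetilde\nabla S=0$, and the following hold. 1. Suppose $t\neq\lambda+2\mu$. The group $SU(1,1)\times U(1)$ acts on $(\mathbb H^3_1,g_{\lambda\mu\nu})$ by isometries through $$(A_0,e^{is})\cdot Z=A_0\,Z\begin{pmatrix}e^{-is}&0\\0&e^{is}\end{pmatrix},$$ and this action is transitive and almost effective (the subgroup acting trivially is discrete). Through the surjective homomorphism $SU(1,1)\times U(1)\to U(1,1)$, $(A_0,e^{is})\mapsto e^{-is}A_0$, it descends to the action $u\cdot Z=u\,Z\,\mathrm{diag}(1,\det u)^{-1}$ of $U(1,1)$, which is isometric, transitive and effective. The decomposition $\mathfrak u(1,1)=\mathfrak m\oplus\mathfrak h$ with the one-dimensional subalgebra $$\mathfrak h=\mathrm{span}_{\mathbb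 R}\left\{\begin{pmatrix}0&0\\0&i\end{pmatrix}\right\},\qquad \mathfrak m=\mathrm{span}_{\mathbb R}\left\{\begin{pmatrix}i&0\\0&\bigl(1+\frac{\lambda-t}{\mu}\bigr)i\end{pmatrix},\begin{pmatrix}0&1\\1&0\end{pmatrix},\begin{pmatrix}0&i\\-i&0\end{pmatrix}\right\}$$ is reductive for this action, and it induces and is induced by $S_\lambda(t)$. 2. Suppose $t=\lambda+2\mu$. Then $SU(1,1)$ acts on $(\mathbb H^3_1,g_{\lambda\mu\nu})$ by left multiplication isometrically, transitively and effectively, and the trivial decomposition $\mathfrak{su}(1,1)=\mathfrak{su}(1,1)\oplus 0$ is reductive for this action and induces and is induced by $S_\lambda(t)$. -/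

import Mathlib

open scoped ContDiff Matrix

noncomputable section

namespace AdS

/-! ### The hypersurface `H31` and smooth functions on it -/

/-- Complex `2 × 2` matrices. -/
abbrev Mat : Type := Matrix (Fin 2) (Fin 2) ℂ

/-- The quadratic form `|w₁|² - |w₂|²` on `ℂ²`. -/
def quad (w : ℂ × ℂ) : ℝ := Complex.normSq w.1 - Complex.normSq w.2

/-- The hypersurface `|z₁|² - |z₂|² = 1` of `ℂ² = ℝ⁴`. -/
abbrev H31 : Type := {z : ℂ × ℂ // quad z = 1}

/-- The base point `(1, 0)`. -/
def o : H31 := ⟨(1, 0), by simp [quad]⟩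

/-- The open cone over `H31`. -/
def cone : Set (ℂ × ℂ) := {w | 0 < quad w}

/-- The radial retraction of the open cone onto `H31` (the value off the cone is irrelevant). -/
def radial (w : ℂ × ℂ) : H31 :=
  if h : 0 < quad w then
    ⟨((Real.sqrt (quad w))⁻¹ : ℝ) • w, by
      have h2 : Real.sqrt (quad w) * Real.sqrt (quad w) = quad w := Real.mul_self_sqrt h.le
      have h3 : Real.sqrt (quad w) ≠ 0 := (Real.sqrt_pos.mpr h).ne'
      have h4 : quad (((Real.sqrt (quad w))⁻¹ : ℝ) • w)
          = (Real.sqrt (quad w))⁻¹ * (Real.sqrt (quad w))⁻¹ * quad w := by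
        simp only [quad, Prod.smul_fst, Prod.smul_snd, Complex.real_smul, Complex.normSq_mul,
          Complex.normSq_ofReal]
        ring
      rw [h4]
      nth_rewrite 3 [← h2]
      field_simp⟩
  else o

/-- A map on `H31` is smooth if its extension to the open cone that is constant along rays
is smooth. -/
def IsSmooth {F : Type*} [NormedAddCommGroup F] [NormedSpace ℝ F] (f : H31 → F) : Prop :=
  ContDiffOn ℝ ∞ (fun w => f (radial w)) cone

/-- The differential `df_z(v)` of a map on `H31`, for `v` tangent to `H31` at `z`. -/
def dirD {F : Type*} [NormedAddCommGroup F] [NormedSpace ℝ F] (f : H31 → F) (z : H31)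
    (v : ℂ × ℂ) : F :=
  fderiv ℝ (fun w => f (radial w)) z.1 v

/-- The real bilinear form polarizing `quad`. -/
def bil (z v : ℂ × ℂ) : ℝ := (star z.1 * v.1 - star z.2 * v.2).re

/-- The tangent space of `H31` at `z`, as a real subspace of `ℂ²`. -/
def tangent (z : H31) : Submodule ℝ (ℂ × ℂ) where
  carrier := {v | bil z.1 v = 0}
  add_mem' := by
    intro a b ha hb
    simp only [bil, Set.mem_ofPred_eq, Prod.fst_add, Prod.snd_add, Complex.sub_re] at *
    rw [mul_add, mul_add, Complex.add_re, Complex.add_re]; linarith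
  zero_mem' := by simp [bil]
  smul_mem' := by
    intro c a ha
    simp only [bil, Set.mem_ofPred_eq, Prod.smul_fst, Prod.smul_snd, mul_smul_comm,
      ← smul_sub] at *
    rw [Complex.smul_re, ha, smul_zero]

instance (z : H31) : AddCommGroup (tangent z) := Submodule.addCommGroup (tangent z)
instance (z : H31) : Ring (Module.End ℝ (tangent z)) := Module.End.instRing
instance (z : H31) : LieRing (Module.End ℝ (tangent z)) := LieRing.ofAssociativeRing

theorem isOpen_cone : IsOpen cone := by
  unfold cone quad
  exact isOpen_lt continuous_const
    ((Complex.continuous_normSq.comp continuous_fst).sub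
      (Complex.continuous_normSq.comp continuous_snd))

theorem mem_cone (z : H31) : z.1 ∈ cone := by
  have := z.2
  simp [cone, this]

theorem contDiff_quad : ContDiff ℝ ∞ quad := by
  have h : quad = fun w : ℂ × ℂ =>
      (Complex.reCLM w.1 * Complex.reCLM w.1 + Complex.imCLM w.1 * Complex.imCLM w.1)
      - (Complex.reCLM w.2 * Complex.reCLM w.2 + Complex.imCLM w.2 * Complex.imCLM w.2) := by
    funext w; simp [quad, Complex.normSq_apply]
  rw [h]
  fun_prop

theorem radial_of_mem {w : ℂ × ℂ} (h : w ∈ cone) :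
    (radial w).1 = ((Real.sqrt (quad w))⁻¹ : ℝ) • w := by
  have h' : 0 < quad w := h
  simp [radial, h']

theorem radial_coe (z : H31) : radial z.1 = z := by
  apply Subtype.ext
  rw [radial_of_mem (mem_cone z), z.2]
  simp

theorem isSmooth_coe : IsSmooth (fun z : H31 => z.1) := by
  unfold IsSmooth
  have : ContDiffOn ℝ ∞ (fun w : ℂ × ℂ => ((Real.sqrt (quad w))⁻¹ : ℝ) • w) cone := by
    refine ContDiffOn.smul (f := fun w : ℂ × ℂ => (Real.sqrt (quad w))⁻¹)
      (g := fun w : ℂ × ℂ => w) ?_ contDiffOn_id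
    apply ContDiffOn.inv
    · exact contDiff_quad.contDiffOn.sqrt (fun w hw => (ne_of_gt hw))
    · intro w hw
      exact (Real.sqrt_pos.mpr hw).ne'
  exact this.congr (fun w hw => radial_of_mem hw)

/-- Restrictions of smooth maps on `ℂ²` are smooth. -/
theorem isSmooth_comp_coe {F : Type*} [NormedAddCommGroup F] [NormedSpace ℝ F]
    {f : ℂ × ℂ → F} (hf : ContDiff ℝ ∞ f) : IsSmooth (fun z : H31 => f z.1) :=
  hf.comp_contDiffOn isSmooth_coe

theorem mapsTo_radial : Set.MapsTo (fun w => (radial w).1) cone cone :=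
  fun w _ => mem_cone (radial w)

theorem IsSmooth.dirD {F : Type*} [NormedAddCommGroup F] [NormedSpace ℝ F] {f : H31 → F}
    (hf : IsSmooth f) {X : H31 → ℂ × ℂ} (hX : IsSmooth X) :
    IsSmooth (fun z => dirD f z (X z)) := by
  unfold IsSmooth AdS.dirD
  have h1 : ContDiffOn ℝ ∞ (fderiv ℝ (fun w => f (radial w))) cone :=
    hf.fderiv_of_isOpen isOpen_cone (by simp)
  exact (h1.comp isSmooth_coe mapsTo_radial).clm_apply hX

/-! ### Vector fields -/

/-- The algebra of smooth real functions on `H31`. -/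
def SmoothFn : Subalgebra ℝ (H31 → ℝ) where
  carrier := {f | IsSmooth f}
  mul_mem' := fun ha hb => ContDiffOn.mul ha hb
  add_mem' := fun ha hb => ContDiffOn.add ha hb
  algebraMap_mem' := fun _ => contDiffOn_const

/-- The `C^∞`-module of smooth vector fields on `H31`. -/
def VF : Submodule SmoothFn (H31 → ℂ × ℂ) where
  carrier := {X | IsSmooth X ∧ ∀ z, X z ∈ tangent z}
  add_mem' := fun ha hb => ⟨ContDiffOn.add ha.1 hb.1, fun z => (tangent z).add_mem (ha.2 z) (hb.2 z)⟩
  zero_mem' := ⟨contDiffOn_const, fun z => (tangent z).zero_mem⟩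
  smul_mem' := fun c _ hx => ⟨ContDiffOn.smul c.2 hx.1, fun z => (tangent z).smul_mem _ (hx.2 z)⟩

/- Shortcuts for instance search. -/
instance : CommRing SmoothFn := Subalgebra.toCommRing SmoothFn
instance : AddCommGroup VF := Submodule.addCommGroup VF
instance : Module SmoothFn VF := Submodule.module VF
instance : SMul SmoothFn VF := Module.toDistribMulAction.toSMul
instance : Module ℝ VF := Submodule.module' VF
instance : IsScalarTower ℝ SmoothFn VF := Submodule.isScalarTower VF

/-- The value at `z` of a vector field. -/
def valAt (X : VF) (z : H31) : tangent z := ⟨X.1 z, X.2.2 z⟩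

/-- The derivative `X f` of a function along a vector field. -/
def derivAlong (X : VF) (f : SmoothFn) : SmoothFn :=
  ⟨fun z => dirD f.1 z (X.1 z), IsSmooth.dirD f.2 X.2.1⟩

theorem bil_symm (u v : ℂ × ℂ) : bil u v = bil v u := by
  simp [bil]; ring

theorem bil_dirD (X Y : VF) (z : H31) :
    bil (X.1 z) (Y.1 z) + bil z.1 (dirD Y.1 z (X.1 z)) = 0 := by
  have hd : DifferentiableAt ℝ (fun w => Y.1 (radial w)) z.1 :=
    ((Y.2.1.contDiffAt (isOpen_cone.mem_nhds (mem_cone z))).differentiableAt (by simp))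
  set G : ℂ × ℂ → ℂ × ℂ := fun w => Y.1 (radial w) with hG
  have hG0 : G z.1 = Y.1 z := by simp [hG, radial_coe]
  have hB : (fun w => bil w (G w)) =ᶠ[nhds z.1] fun _ => (0 : ℝ) := by
    filter_upwards [isOpen_cone.mem_nhds (mem_cone z)] with w hw
    have h1 : bil (radial w).1 (G w) = 0 := Y.2.2 (radial w)
    rw [radial_of_mem hw] at h1
    have h2 : bil (((Real.sqrt (quad w))⁻¹ : ℝ) • w) (G w)
        = (Real.sqrt (quad w))⁻¹ * bil w (G w) := by
      simp [bil]; ring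
    rw [h2] at h1
    have h3 : (Real.sqrt (quad w))⁻¹ ≠ 0 := inv_ne_zero (Real.sqrt_pos.mpr hw).ne'
    exact (mul_eq_zero.mp h1).resolve_left h3
  have h0 : HasFDerivAt (fun w => bil w (G w)) (0 : (ℂ × ℂ) →L[ℝ] ℝ) z.1 :=
    (hasFDerivAt_const (0 : ℝ) z.1).congr_of_eventuallyEq hB
  have hc : HasDerivAt (fun s : ℝ => z.1 + s • X.1 z) (X.1 z) 0 := by
    simpa using ((hasDerivAt_id (0 : ℝ)).smul_const (X.1 z)).const_add z.1
  have hz : z.1 = z.1 + (0 : ℝ) • X.1 z := by simp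
  have e1 : HasDerivAt (fun s : ℝ => bil (z.1 + s • X.1 z) (G (z.1 + s • X.1 z))) 0 0 := by
    have := HasFDerivAt.comp_hasDerivAt (0 : ℝ) (hz ▸ h0) hc
    simpa [Function.comp_def] using this
  have e2 : HasDerivAt (fun s : ℝ => G (z.1 + s • X.1 z)) (fderiv ℝ G z.1 (X.1 z)) 0 := by
    have h5 : HasFDerivAt G (fderiv ℝ G z.1) (z.1 + (0 : ℝ) • X.1 z) := by
      simpa using hd.hasFDerivAt
    exact HasFDerivAt.comp_hasDerivAt (0 : ℝ) h5 hc
  have c1 := (Complex.reCLM.hasFDerivAt.comp_hasDerivAt (0 : ℝ)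
    (((ContinuousLinearMap.fst ℝ ℂ ℂ).hasFDerivAt.comp_hasDerivAt (0 : ℝ) hc).star.mul
      ((ContinuousLinearMap.fst ℝ ℂ ℂ).hasFDerivAt.comp_hasDerivAt (0 : ℝ) e2)))
  have c2 := (Complex.reCLM.hasFDerivAt.comp_hasDerivAt (0 : ℝ)
    (((ContinuousLinearMap.snd ℝ ℂ ℂ).hasFDerivAt.comp_hasDerivAt (0 : ℝ) hc).star.mul
      ((ContinuousLinearMap.snd ℝ ℂ ℂ).hasFDerivAt.comp_hasDerivAt (0 : ℝ) e2)))
  have e3 := c1.sub c2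
  have e4 := HasDerivAt.unique e3 (by simpa [bil, Function.comp_def, Pi.sub_def] using e1)
  have hD : dirD Y.1 z (X.1 z) = fderiv ℝ G z.1 (X.1 z) := rfl
  rw [hD, ← hG0]
  simp only [bil] at *
  simp at e4 ⊢
  linarith

/-- The Lie bracket of vector fields. -/
def bracket (X Y : VF) : VF :=
  ⟨fun z => dirD Y.1 z (X.1 z) - dirD X.1 z (Y.1 z),
    ContDiffOn.sub (IsSmooth.dirD Y.2.1 X.2.1) (IsSmooth.dirD X.2.1 Y.2.1), by
    intro z
    have h1 := bil_dirD X Y z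
    have h2 := bil_dirD Y X z
    rw [bil_symm] at h2
    have h3 : bil z.1 (dirD Y.1 z (X.1 z) - dirD X.1 z (Y.1 z))
        = bil z.1 (dirD Y.1 z (X.1 z)) - bil z.1 (dirD X.1 z (Y.1 z)) := by
      simp [bil]; ring
    change bil z.1 _ = 0
    rw [h3]; linarith⟩

/-! ### The left-invariant frame, its dual frame, the metric and the tensor `S_λ(t)` -/

/-- The identification of `(z₁, z₂)` with a matrix. -/
def toMat (z : ℂ × ℂ) : Mat := !![z.1, z.2; star z.2, star z.1]

/-- The Pauli-like basis `X₀, X₁, X₂` of `su(1,1)`. -/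
def pauli : Fin 3 → Mat :=
  ![!![Complex.I, 0; 0, -Complex.I], !![0, 1; 1, 0], !![0, Complex.I; -Complex.I, 0]]

/-- The values of the left-invariant vector fields `X₀, X₁, X₂`. -/
def frameFun (a : Fin 3) (z : H31) : ℂ × ℂ :=
  ((toMat z.1 * pauli a) 0 0, (toMat z.1 * pauli a) 0 1)

theorem toMat_frameFun (a : Fin 3) (z : H31) :
    toMat (frameFun a z) = toMat z.1 * pauli a := by
  fin_cases a <;> ext i j <;> fin_cases i <;> fin_cases j <;>
    simp [frameFun, toMat, pauli, Matrix.mul_apply, Fin.sum_univ_two]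

/-- The left-invariant vector fields `X₀, X₁, X₂`. -/
def frame (a : Fin 3) : VF :=
  ⟨frameFun a, by
    have h : ContDiff ℝ ∞ (fun z : ℂ × ℂ =>
        ((toMat z * pauli a) 0 0, (toMat z * pauli a) 0 1)) := by
      fin_cases a <;> simp [toMat, pauli, Matrix.mul_apply, Fin.sum_univ_two] <;> fun_prop
    exact isSmooth_comp_coe h, by
    intro z
    change bil _ _ = 0
    fin_cases a <;>
      simp [bil, frameFun, toMat, pauli, Matrix.mul_apply, Fin.sum_univ_two] <;> ring⟩

/-- The dual frame `θ⁰, θ¹, θ²`: the coordinates of `z⁻¹ v ∈ su(1,1)` in the basis `pauli`. -/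
def theta (a : Fin 3) (z : H31) (v : ℂ × ℂ) : ℝ :=
  ![(star z.1.1 * v.1 - z.1.2 * star v.2).im,
    (star z.1.1 * v.2 - z.1.2 * star v.1).re,
    (star z.1.1 * v.2 - z.1.2 * star v.1).im] a

theorem theta_frame (a b : Fin 3) (z : H31) :
    theta a z ((frame b).1 z) = if a = b then 1 else 0 := by
  have hz := z.2
  simp only [quad, Complex.normSq_apply] at hz
  fin_cases a <;> fin_cases b <;>
    simp [theta, frame, frameFun, toMat, pauli, Matrix.mul_apply, Fin.sum_univ_two] <;>
    linarith

theorem sum_theta_frame (z : H31) (v : ℂ × ℂ) (hv : v ∈ tangent z) :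
    ∑ a, theta a z v • (frame a).1 z = v := by
  have hz := z.2
  have hv' : bil z.1 v = 0 := hv
  simp only [quad, Complex.normSq_apply] at hz
  simp [bil] at hv'
  apply Prod.ext <;> apply Complex.ext <;>
    simp [theta, frame, frameFun, toMat, pauli, Matrix.mul_apply, Fin.sum_univ_two,
      Fin.sum_univ_three] <;> grind

theorem theta_add (a : Fin 3) (z : H31) (u v : ℂ × ℂ) :
    theta a z (u + v) = theta a z u + theta a z v := by
  fin_cases a <;> simp [theta] <;> ring

theorem theta_smul (a : Fin 3) (z : H31) (c : ℝ) (v : ℂ × ℂ) :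
    theta a z (c • v) = c * theta a z v := by
  fin_cases a <;> simp [theta] <;> ring

/-- The function `θᵃ(X)`. -/
def coord (a : Fin 3) (X : VF) : SmoothFn :=
  ⟨fun z => theta a z (X.1 z), by
    have hX : IsSmooth X.1 := X.2.1
    have hz := isSmooth_coe
    have h : ContDiff ℝ ∞ (fun p : (ℂ × ℂ) × (ℂ × ℂ) =>
        (![(star p.1.1 * p.2.1 - p.1.2 * star p.2.2).im,
          (star p.1.1 * p.2.2 - p.1.2 * star p.2.1).re,
          (star p.1.1 * p.2.2 - p.1.2 * star p.2.1).im] a : ℝ)) := by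
      have s1 : ContDiff ℝ ∞ (fun p : (ℂ × ℂ) × (ℂ × ℂ) =>
          star p.1.1 * p.2.1 - p.1.2 * star p.2.2) := by
        have : ContDiff ℝ ∞ (fun z : ℂ => star z) := Complex.conjCLE.contDiff
        fun_prop
      have s2 : ContDiff ℝ ∞ (fun p : (ℂ × ℂ) × (ℂ × ℂ) =>
          star p.1.1 * p.2.2 - p.1.2 * star p.2.1) := by
        have : ContDiff ℝ ∞ (fun z : ℂ => star z) := Complex.conjCLE.contDiff
        fun_prop
      fin_cases a
      · exact Complex.imCLM.contDiff.comp s1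
      · exact Complex.reCLM.contDiff.comp s2
      · exact Complex.imCLM.contDiff.comp s2
    exact h.comp_contDiffOn (ContDiffOn.prodMk hz hX)⟩

/-- The metric `λ θ⁰⊗θ⁰ + μ θ¹⊗θ¹ + ν θ²⊗θ²` at the point `z`. -/
def metric (lam mu nu : ℝ) (z : H31) (u v : ℂ × ℂ) : ℝ :=
  lam * (theta 0 z u * theta 0 z v) + mu * (theta 1 z u * theta 1 z v)
    + nu * (theta 2 z u * theta 2 z v)

/-- The smooth function `g(X, Y)`. -/
def metricFn (lam mu nu : ℝ) (X Y : VF) : SmoothFn :=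
  lam • (coord 0 X * coord 0 Y) + mu • (coord 1 X * coord 1 Y) + nu • (coord 2 X * coord 2 Y)

theorem metricFn_apply (lam mu nu : ℝ) (X Y : VF) (z : H31) :
    (metricFn lam mu nu X Y).1 z = metric lam mu nu z (X.1 z) (Y.1 z) := rfl

/-- `(θᵃ ∧ θᵇ)(X, Y)`. -/
def wedge (a b : Fin 3) (X Y : VF) : SmoothFn := coord a X * coord b Y - coord b X * coord a Y

/-- The `(0,3)`-tensor field
`S_λ(t) = -λ θ²⊗(θ⁰∧θ¹) + t θ⁰⊗(θ¹∧θ²) - λ θ¹⊗(θ²∧θ⁰)`. -/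
def S03 (lam t : ℝ) (X Y Z : VF) : SmoothFn :=
  (-lam) • (coord 2 X * wedge 0 1 Y Z) + t • (coord 0 X * wedge 1 2 Y Z)
    - lam • (coord 1 X * wedge 2 0 Y Z)

/-- Tensor fields of type `(1,2)`: `C^∞`-bilinear maps `(X, Y) ↦ S_X Y`. -/
structure Tensor12 where
  app : VF → VF → VF
  add_left : ∀ X X' Y, app (X + X') Y = app X Y + app X' Y
  smul_left : ∀ (f : SmoothFn) X Y, app (f • X) Y = f • app X Y
  add_right : ∀ X Y Y', app X (Y + Y') = app X Y + app X Y'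
  smul_right : ∀ (f : SmoothFn) X Y, app X (f • Y) = f • app X Y

theorem coord_add (a : Fin 3) (X Y : VF) : coord a (X + Y) = coord a X + coord a Y :=
  Subtype.ext (funext fun z => theta_add a z (X.1 z) (Y.1 z))

theorem coord_smul (a : Fin 3) (f : SmoothFn) (X : VF) : coord a (f • X) = f * coord a X :=
  Subtype.ext (funext fun z => theta_smul a z (f.1 z) (X.1 z))

theorem S03_add_left (lam t : ℝ) (X X' Y Z : VF) :
    S03 lam t (X + X') Y Z = S03 lam t X Y Z + S03 lam t X' Y Z := by
  simp only [S03, coord_add, Algebra.smul_def]; ring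

theorem S03_smul_left (lam t : ℝ) (f : SmoothFn) (X Y Z : VF) :
    S03 lam t (f • X) Y Z = f * S03 lam t X Y Z := by
  simp only [S03, coord_smul, Algebra.smul_def]; ring

theorem S03_add_mid (lam t : ℝ) (X Y Y' Z : VF) :
    S03 lam t X (Y + Y') Z = S03 lam t X Y Z + S03 lam t X Y' Z := by
  simp only [S03, wedge, coord_add, Algebra.smul_def]; ring

theorem S03_smul_mid (lam t : ℝ) (f : SmoothFn) (X Y Z : VF) :
    S03 lam t X (f • Y) Z = f * S03 lam t X Y Z := by
  simp only [S03, wedge, coord_smul, Algebra.smul_def]; ring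

/-- The `(1,2)`-tensor field `S_λ(t)` on `(H31, g_{λμν})`, obtained from the `(0,3)`-tensor field
by raising the last index: `S_X Y = ∑ₐ g(Xₐ, Xₐ)⁻¹ S(X, Y, Xₐ) Xₐ`. -/
def S12 (lam mu nu t : ℝ) : Tensor12 where
  app X Y := ∑ a : Fin 3, ((![lam, mu, nu] a)⁻¹ • S03 lam t X Y (frame a)) • frame a
  add_left X X' Y := by
    simp only [S03_add_left, smul_add, add_smul, Finset.sum_add_distrib]
  smul_left f X Y := by
    rw [Finset.smul_sum]
    refine Finset.sum_congr rfl fun a _ => ?_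
    rw [S03_smul_left, smul_smul, mul_smul_comm]
  add_right X Y Y' := by
    simp only [S03_add_mid, smul_add, add_smul, Finset.sum_add_distrib]
  smul_right f X Y := by
    rw [Finset.smul_sum]
    refine Finset.sum_congr rfl fun a _ => ?_
    rw [S03_smul_mid, smul_smul, mul_smul_comm]

theorem coord_frame (a b : Fin 3) : coord a (frame b) = if a = b then 1 else 0 := by
  apply Subtype.ext; funext z
  have := theta_frame a b z
  change theta a z ((frame b).1 z) = _
  rw [this]; split_ifs <;> rfl

/-- The two forms of `S_λ(t)` are related by `g(S_X Y, Z) = S(X, Y, Z)`. -/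
theorem metricFn_S12 (lam mu nu t : ℝ) (hlam : lam ≠ 0) (hmu : mu ≠ 0) (hnu : nu ≠ 0)
    (X Y Z : VF) :
    metricFn lam mu nu ((S12 lam mu nu t).app X Y) Z = S03 lam t X Y Z := by
  apply Subtype.ext; funext z
  have h : ∀ a b, (coord a (frame b)).1 z = if a = b then 1 else 0 := fun a b => by
    rw [coord_frame]; split_ifs <;> rfl
  have e : ∀ Y Z, (S03 lam t X Y Z).1 z = (-lam) * ((coord 2 X).1 z *
      ((coord 0 Y).1 z * (coord 1 Z).1 z - (coord 1 Y).1 z * (coord 0 Z).1 z))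
      + t * ((coord 0 X).1 z *
      ((coord 1 Y).1 z * (coord 2 Z).1 z - (coord 2 Y).1 z * (coord 1 Z).1 z))
      - lam * ((coord 1 X).1 z *
      ((coord 2 Y).1 z * (coord 0 Z).1 z - (coord 0 Y).1 z * (coord 2 Z).1 z)) :=
    fun _ _ => rfl
  have c : ∀ a, (coord a ((S12 lam mu nu t).app X Y)).1 z
      = (![lam, mu, nu] a)⁻¹ * (S03 lam t X Y (frame a)).1 z := by
    intro a
    have : coord a ((S12 lam mu nu t).app X Y)
        = ∑ b : Fin 3, ((![lam, mu, nu] b)⁻¹ • S03 lam t X Y (frame b)) * coord a (frame b) := by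
      simp only [S12, Fin.sum_univ_three, coord_add, coord_smul]
    rw [this]
    simp only [coord_frame, mul_ite, mul_one, mul_zero, Finset.sum_ite_eq, Finset.mem_univ,
      if_true]
    rfl
  have m : (metricFn lam mu nu ((S12 lam mu nu t).app X Y) Z).1 z
      = lam * ((coord 0 ((S12 lam mu nu t).app X Y)).1 z * (coord 0 Z).1 z)
      + mu * ((coord 1 ((S12 lam mu nu t).app X Y)).1 z * (coord 1 Z).1 z)
      + nu * ((coord 2 ((S12 lam mu nu t).app X Y)).1 z * (coord 2 Z).1 z) := rfl
  rw [m, c, c, c, e, e, e, e]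
  simp [h]
  field_simp
  ring

/-! ### Affine connections -/

/-- Affine connections on `H31`, as covariant derivatives `(X, Y) ↦ ∇_X Y` of vector fields. -/
structure Connection where
  cov : VF → VF → VF
  add_left : ∀ X X' Y, cov (X + X') Y = cov X Y + cov X' Y
  smul_left : ∀ (f : SmoothFn) X Y, cov (f • X) Y = f • cov X Y
  add_right : ∀ X Y Y', cov X (Y + Y') = cov X Y + cov X Y'
  leibniz : ∀ X (f : SmoothFn) Y, cov X (f • Y) = derivAlong X f • Y + f • cov X Y

/-- The connection `∇ - S`. -/
def Connection.subTensor (D : Connection) (S : Tensor12) : Connection where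
  cov X Y := D.cov X Y - S.app X Y
  add_left X X' Y := by rw [D.add_left, S.add_left]; abel
  smul_left f X Y := by rw [D.smul_left, S.smul_left, smul_sub]
  add_right X Y Y' := by rw [D.add_right, S.add_right]; abel
  leibniz X f Y := by rw [D.leibniz, S.smul_right, smul_sub]; abel

/-- The curvature `R(X,Y)Z = ∇_X ∇_Y Z - ∇_Y ∇_X Z - ∇_[X,Y] Z`. -/
def Connection.curv (D : Connection) (X Y Z : VF) : VF :=
  D.cov X (D.cov Y Z) - D.cov Y (D.cov X Z) - D.cov (bracket X Y) Z

/-- `∇ g = 0`. -/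
def Connection.IsMetric (D : Connection) (lam mu nu : ℝ) : Prop :=
  ∀ X Y Z : VF, derivAlong X (metricFn lam mu nu Y Z)
    = metricFn lam mu nu (D.cov X Y) Z + metricFn lam mu nu Y (D.cov X Z)

/-- `D` is the Levi-Civita connection of `g_{λμν}`. -/
structure Connection.IsLeviCivita (D : Connection) (lam mu nu : ℝ) : Prop where
  metric : D.IsMetric lam mu nu
  torsionFree : ∀ X Y : VF, D.cov X Y - D.cov Y X = bracket X Y

/-- Given the Levi-Civita connection `D` of `g_{λμν}`, the tensor field `S` is a homogeneous
pseudo-Riemannian structure: `∇' = D - S` satisfies `∇' g = 0`, `∇' R = 0`, `∇' S = 0`. -/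
structure IsHomogeneousStructure (lam mu nu : ℝ) (D : Connection) (S : Tensor12) : Prop where
  metric : (D.subTensor S).IsMetric lam mu nu
  curvature : ∀ X Y Z W : VF,
    (D.subTensor S).cov X (D.curv Y Z W) =
      D.curv ((D.subTensor S).cov X Y) Z W + D.curv Y ((D.subTensor S).cov X Z) W
        + D.curv Y Z ((D.subTensor S).cov X W)
  tensor : ∀ X Y Z : VF,
    (D.subTensor S).cov X (S.app Y Z) =
      S.app ((D.subTensor S).cov X Y) Z + S.app Y ((D.subTensor S).cov X Z)

/-- The vector field with constant coefficients in the left-invariant frame extending `v ∈ T_z`. -/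
def ext (z : H31) : tangent z →ₗ[ℝ] VF where
  toFun v := ∑ a, theta a z v.1 • frame a
  map_add' u v := by
    simp only [Submodule.coe_add, theta_add, add_smul, Finset.sum_add_distrib]
  map_smul' c v := by
    simp only [Submodule.coe_smul, theta_smul, mul_smul, Finset.smul_sum, RingHom.id_apply]

theorem ext_at (z : H31) (v : tangent z) : valAt (ext z v) z = v := by
  apply Subtype.ext
  have := sum_theta_frame z v.1 v.2
  simpa [valAt, ext] using this

theorem dirD_const (c : ℝ) (z : H31) (v : ℂ × ℂ) : dirD (fun _ : H31 => c) z v = 0 := by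
  simp [dirD]

theorem Connection.real_smul_right (D : Connection) (c : ℝ) (X Y : VF) :
    D.cov X (c • Y) = c • D.cov X Y := by
  have h : ∀ Z : VF, c • Z = (algebraMap ℝ SmoothFn c) • Z := fun Z => by
    rw [algebraMap_smul]
  have h0 : derivAlong X (algebraMap ℝ SmoothFn c) = 0 :=
    Subtype.ext (funext fun z => dirD_const c z (X.1 z))
  rw [h, D.leibniz, h0, zero_smul, zero_add, ← h]

theorem Connection.curv_add (D : Connection) (X Y Z Z' : VF) :
    D.curv X Y (Z + Z') = D.curv X Y Z + D.curv X Y Z' := by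
  simp only [Connection.curv, D.add_right]; abel

theorem Connection.curv_real_smul (D : Connection) (c : ℝ) (X Y Z : VF) :
    D.curv X Y (c • Z) = c • D.curv X Y Z := by
  simp only [Connection.curv, D.real_smul_right, smul_sub]

/-- The curvature endomorphism `R(x,y)` of `T_z`. -/
def Connection.curvAt (D : Connection) (z : H31) (x y : tangent z) :
    Module.End ℝ (tangent z) where
  toFun v := valAt (D.curv (ext z x) (ext z y) (ext z v)) z
  map_add' u v := by rw [map_add, D.curv_add]; rfl
  map_smul' c v := by rw [map_smul, D.curv_real_smul]; rfl

/-- The value `S_x y ∈ T_z` of a `(1,2)`-tensor field on tangent vectors `x, y ∈ T_z`. -/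
def tensorAt (S : Tensor12) (z : H31) (x y : tangent z) : tangent z :=
  valAt (S.app (ext z x) (ext z y)) z

/-- The Lie algebra of endomorphisms of `T_z` generated by the curvature endomorphisms. -/
def Connection.holonomyAlgebra (D : Connection) (z : H31) :
    LieSubalgebra ℝ (Module.End ℝ (tangent z)) :=
  LieSubalgebra.lieSpan ℝ (Module.End ℝ (tangent z)) {U | ∃ x y, U = D.curvAt z x y}

/-- The bracket on pairs `(U, x)`, `U ∈ End(T_z)`, `x ∈ T_z`, attached to a `(1,2)`-tensor field
`S` and a connection with curvature `R`: `[U,V] = UV - VU`, `[U,x] = U x`,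
`[x,y] = S_x y - S_y x - R(x,y)`. -/
def modelBracket (D : Connection) (S : Tensor12) (z : H31)
    (p q : Module.End ℝ (tangent z) × tangent z) : Module.End ℝ (tangent z) × tangent z :=
  (p.1 * q.1 - q.1 * p.1 - D.curvAt z p.2 q.2,
    p.1 q.2 - q.1 p.2 + tensorAt S z p.2 q.2 - tensorAt S z q.2 p.2)

/-! ### The groups and their actions -/

/-- The Hermitian form of signature `(1,1)`. -/
def J : Mat := !![1, 0; 0, -1]

/-- The group `U(1,1)`. -/
def U11 : Subgroup (GL (Fin 2) ℂ) where
  carrier := {A | A.1ᴴ * J * A.1 = J}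
  mul_mem' := by
    intro A B hA hB
    simp only [Set.mem_ofPred_eq] at *
    calc (A * B).1ᴴ * J * (A * B).1 = B.1ᴴ * (A.1ᴴ * J * A.1) * B.1 := by
          simp [Matrix.conjTranspose_mul, Matrix.mul_assoc]
      _ = J := by rw [hA, hB]
  one_mem' := by simp
  inv_mem' := by
    intro A hA
    simp only [Set.mem_ofPred_eq] at *
    have h1 : A.1 * (A⁻¹).1 = 1 := A.mul_inv
    have h2 : (A⁻¹).1ᴴ * A.1ᴴ = 1 := by
      rw [← Matrix.conjTranspose_mul, h1, Matrix.conjTranspose_one]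
    calc (A⁻¹).1ᴴ * J * (A⁻¹).1 = (A⁻¹).1ᴴ * (A.1ᴴ * J * A.1) * (A⁻¹).1 := by rw [hA]
      _ = ((A⁻¹).1ᴴ * A.1ᴴ) * J * (A.1 * (A⁻¹).1) := by simp only [Matrix.mul_assoc]
      _ = J := by rw [h1, h2, Matrix.one_mul, Matrix.mul_one]

/-- The group `SU(1,1)`. -/
def SU11 : Subgroup (GL (Fin 2) ℂ) := U11 ⊓ (Matrix.GeneralLinearGroup.det).ker

theorem SU11_det (A : SU11) : A.1.1.det = 1 := by
  have h : Matrix.GeneralLinearGroup.det A.1 = 1 := A.2.2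
  have := congrArg Units.val h
  simpa using this

theorem SU11_entries (A : SU11) :
    A.1.1 1 1 = star (A.1.1 0 0) ∧ A.1.1 1 0 = star (A.1.1 0 1) := by
  have hd := SU11_det A
  have hu : A.1.1ᴴ * J * A.1.1 = J := A.2.1
  have h2 : A.1.1 * A.1.1.adjugate = 1 := by rw [Matrix.mul_adjugate, hd, one_smul]
  have h3 : A.1.1ᴴ * J = J * A.1.1.adjugate := by
    calc A.1.1ᴴ * J = A.1.1ᴴ * J * (A.1.1 * A.1.1.adjugate) := by rw [h2, Matrix.mul_one]
      _ = (A.1.1ᴴ * J * A.1.1) * A.1.1.adjugate := by simp only [Matrix.mul_assoc]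
      _ = J * A.1.1.adjugate := by rw [hu]
  rw [Matrix.adjugate_fin_two] at h3
  have e00 := congrFun (congrFun h3 0) 0
  have e01 := congrFun (congrFun h3 0) 1
  simp [J, Matrix.mul_apply, Fin.sum_univ_two] at e00 e01
  refine ⟨?_, ?_⟩
  · simpa using e00.symm
  · have := congrArg star e01
    simpa using this

/-- The identification of `H31` with `SU(1,1)` given by `toMat`. -/
def toSU : H31 ≃ SU11 where
  toFun z := ⟨Matrix.GeneralLinearGroup.mkOfDetNeZero (toMat z.1) (by
      have hz := z.2
      simp only [quad] at hz
      have : (toMat z.1).det = ((Complex.normSq z.1.1 - Complex.normSq z.1.2 : ℝ) : ℂ) := by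
        simp [toMat, Matrix.det_fin_two, Complex.mul_conj]
      rw [this, hz]; simp), by
    have hz := z.2
    simp only [quad] at hz
    have hz' : z.1.1 * star z.1.1 - z.1.2 * star z.1.2 = 1 := by
      have : ((Complex.normSq z.1.1 - Complex.normSq z.1.2 : ℝ) : ℂ) = 1 := by rw [hz]; simp
      simpa [Complex.mul_conj] using this
    simp only [RCLike.star_def] at hz'
    refine ⟨?_, ?_⟩
    · change (toMat z.1)ᴴ * J * toMat z.1 = J
      ext i j
      fin_cases i <;> fin_cases j <;>
        simp [toMat, J, Matrix.mul_apply, Fin.sum_univ_two] <;> grind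
    · apply Units.ext
      change (toMat z.1).det = 1
      simpa [toMat, Matrix.det_fin_two] using hz'⟩
  invFun A := ⟨(A.1.1 0 0, A.1.1 0 1), by
    have hd := SU11_det A
    obtain ⟨h1, h2⟩ := SU11_entries A
    rw [Matrix.det_fin_two, h1, h2] at hd
    have := congrArg Complex.re hd
    simpa [quad, Complex.normSq_apply] using this⟩
  left_inv z := by
    apply Subtype.ext
    apply Prod.ext <;> simp [Matrix.GeneralLinearGroup.mkOfDetNeZero, toMat]
  right_inv A := by
    obtain ⟨h1, h2⟩ := SU11_entries A
    apply Subtype.ext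
    apply Units.ext
    ext i j
    fin_cases i <;> fin_cases j <;>
      simp [Matrix.GeneralLinearGroup.mkOfDetNeZero, toMat] <;> simp_all

theorem toSU_val (z : H31) : (toSU z).1.1 = toMat z.1 := rfl

theorem toMat_symm (A : SU11) : toMat (toSU.symm A).1 = A.1.1 := by
  rw [← toSU_val, Equiv.apply_symm_apply]

theorem circle_mul_star (w : Circle) : (w : ℂ) * star (w : ℂ) = 1 := by
  have := Circle.normSq_coe w
  rw [RCLike.star_def, Complex.mul_conj, this]; simp

/-- `w ↦ diag(w, w⁻¹)`, as a homomorphism from `U(1)` to `SU(1,1)`. -/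
def diagHom : Circle →* SU11 where
  toFun w := toSU ⟨((w : ℂ), 0), by simp [quad]⟩
  map_one' := by
    apply Subtype.ext; apply Units.ext
    rw [toSU_val]; ext i j; fin_cases i <;> fin_cases j <;> simp [toMat]
  map_mul' w w' := by
    apply Subtype.ext; apply Units.ext
    change toMat _ = toMat _ * toMat _
    ext i j
    fin_cases i <;> fin_cases j <;> simp [toMat, Matrix.mul_apply, Fin.sum_univ_two]

/-- The action `(A, w) · Z = A Z diag(w⁻¹, w)` of `SU(1,1) × U(1)` on `H31 ≅ SU(1,1)`. -/
instance actProd : MulAction (SU11 × Circle) H31 where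
  smul g z := toSU.symm (g.1 * toSU z * (diagHom g.2)⁻¹)
  one_smul z := by
    change toSU.symm (1 * toSU z * (diagHom 1)⁻¹) = z
    simp
  mul_smul g h z := by
    change toSU.symm ((g * h).1 * toSU z * (diagHom (g * h).2)⁻¹)
      = toSU.symm (g.1 * toSU (toSU.symm (h.1 * toSU z * (diagHom h.2)⁻¹)) * (diagHom g.2)⁻¹)
    simp [mul_assoc]

/-- The action of `SU(1,1)` on `H31 ≅ SU(1,1)` by left multiplication. -/
instance actLeft : MulAction SU11 H31 where
  smul A z := toSU.symm (A * toSU z)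
  one_smul z := by
    change toSU.symm (1 * toSU z) = z
    simp
  mul_smul A B z := by
    change toSU.symm (A * B * toSU z) = toSU.symm (A * toSU (toSU.symm (B * toSU z)))
    simp [mul_assoc]

theorem U11_det (u : U11) : u.1.1.det * star u.1.1.det = 1 := by
  have hu : u.1.1ᴴ * J * u.1.1 = J := u.2
  have h := congrArg Matrix.det hu
  rw [Matrix.det_mul, Matrix.det_mul, Matrix.det_conjTranspose] at h
  have hJ : J.det = -1 := by simp [J, Matrix.det_fin_two]
  rw [hJ] at h
  linear_combination -h

/-- `u ↦ diag(1, det u)`, as an endomorphism of `U(1,1)`. -/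
def detHom : U11 →* U11 where
  toFun u := ⟨Matrix.GeneralLinearGroup.mkOfDetNeZero !![1, 0; 0, u.1.1.det] (by
      have := U11_det u
      rw [Matrix.det_fin_two_of]
      intro h
      simp at h
      simp [h] at this), by
    have h := U11_det u
    change (!![1, 0; 0, u.1.1.det] : Mat)ᴴ * J * !![1, 0; 0, u.1.1.det] = J
    ext i j
    fin_cases i <;> fin_cases j <;> simp [J, Matrix.mul_apply, Fin.sum_univ_two]
    simpa [mul_comm] using h⟩
  map_one' := by
    apply Subtype.ext; apply Units.ext
    change (!![1, 0; 0, (1 : Mat).det] : Mat) = 1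
    ext i j; fin_cases i <;> fin_cases j <;> simp
  map_mul' u v := by
    apply Subtype.ext; apply Units.ext
    change (!![1, 0; 0, (u.1.1 * v.1.1).det] : Mat)
      = !![1, 0; 0, u.1.1.det] * !![1, 0; 0, v.1.1.det]
    ext i j
    fin_cases i <;> fin_cases j <;> simp [Matrix.mul_apply, Fin.sum_univ_two]

theorem detHom_val (u : U11) : (detHom u).1.1 = !![1, 0; 0, u.1.1.det] := rfl

theorem detHom_comm (u v : U11) : detHom u * detHom v = detHom v * detHom u := by
  apply Subtype.ext; apply Units.ext
  change (!![1, 0; 0, u.1.1.det] : Mat) * !![1, 0; 0, v.1.1.det]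
    = !![1, 0; 0, v.1.1.det] * !![1, 0; 0, u.1.1.det]
  ext i j
  fin_cases i <;> fin_cases j <;> simp [Matrix.mul_apply, Fin.sum_univ_two, mul_comm]

theorem detHom_det (u : U11) : Matrix.GeneralLinearGroup.det (detHom u).1
    = Matrix.GeneralLinearGroup.det u.1 := by
  apply Units.ext
  change (!![1, 0; 0, u.1.1.det] : Mat).det = u.1.1.det
  simp [Matrix.det_fin_two]

/-- The inclusion of `SU(1,1)` in `U(1,1)`. -/
def inclU : SU11 →* U11 := Subgroup.inclusion inf_le_left

/-- The matrix `u A diag(1, det u)⁻¹ ∈ SU(1,1)`, for `u ∈ U(1,1)` and `A ∈ SU(1,1)`. -/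
def uMul (u : U11) (A : SU11) : SU11 :=
  ⟨(u * inclU A * (detHom u)⁻¹ : U11).1, (u * inclU A * (detHom u)⁻¹ : U11).2, by
    have hA : Matrix.GeneralLinearGroup.det (inclU A).1 = 1 := A.2.2
    have h : Matrix.GeneralLinearGroup.det (u.1 * (inclU A).1 * ((detHom u).1)⁻¹) = 1 := by
      rw [map_mul, map_mul, map_inv, hA, detHom_det, mul_one, mul_inv_cancel]
    exact h⟩

theorem inclU_uMul (u : U11) (A : SU11) : inclU (uMul u A) = u * inclU A * (detHom u)⁻¹ := rfl

theorem inclU_injective : Function.Injective inclU := Subgroup.inclusion_injective _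

/-- The action `u · Z = u Z diag(1, det u)⁻¹` of `U(1,1)` on `H31 ≅ SU(1,1)`. -/
instance actU : MulAction U11 H31 where
  smul u z := toSU.symm (uMul u (toSU z))
  one_smul z := by
    change toSU.symm (uMul 1 (toSU z)) = z
    rw [Equiv.symm_apply_eq]
    apply inclU_injective
    rw [inclU_uMul, map_one, one_mul, inv_one, mul_one]
  mul_smul u v z := by
    change toSU.symm (uMul (u * v) (toSU z))
      = toSU.symm (uMul u (toSU (toSU.symm (uMul v (toSU z)))))
    congr 1
    rw [Equiv.apply_symm_apply]
    apply inclU_injective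
    rw [inclU_uMul, inclU_uMul, inclU_uMul, map_mul, detHom_comm, mul_inv_rev]
    have := detHom_comm u v
    simp only [mul_assoc]
    rw [← mul_inv_rev, ← mul_inv_rev, this]

/-- The homomorphism `(A, w) ↦ w⁻¹ A` from `SU(1,1) × U(1)` to `U(1,1)`. -/
def psi : SU11 × Circle →* U11 where
  toFun p := ⟨⟨(p.2 : ℂ)⁻¹ • p.1.1.1, (p.2 : ℂ) • (p.1.1⁻¹).1,
      by rw [smul_mul_smul_comm, inv_mul_cancel₀ p.2.coe_ne_zero, one_smul]; exact p.1.1.mul_inv,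
      by rw [smul_mul_smul_comm, mul_inv_cancel₀ p.2.coe_ne_zero, one_smul]; exact p.1.1.inv_mul⟩,
    by
      have h : p.1.1.1ᴴ * J * p.1.1.1 = J := p.1.2.1
      have hw := circle_mul_star p.2
      change ((p.2 : ℂ)⁻¹ • p.1.1.1)ᴴ * J * ((p.2 : ℂ)⁻¹ • p.1.1.1) = J
      rw [Matrix.conjTranspose_smul, Matrix.smul_mul, smul_mul_smul_comm, h, star_inv₀,
        ← mul_inv, mul_comm, hw, inv_one, one_smul]⟩
  map_one' := by
    apply Subtype.ext; apply Units.ext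
    change ((1 : Circle) : ℂ)⁻¹ • (1 : Mat) = 1
    simp
  map_mul' p q := by
    apply Subtype.ext; apply Units.ext
    change ((p.2 * q.2 : Circle) : ℂ)⁻¹ • (p.1.1.1 * q.1.1.1)
      = ((p.2 : ℂ)⁻¹ • p.1.1.1) * ((q.2 : ℂ)⁻¹ • q.1.1.1)
    rw [smul_mul_smul_comm, Circle.coe_mul, mul_inv]

/-- The bijection `φ` of `H31` is an isometry of `g_{λμν}`: a diffeomorphism whose differential
preserves the metric. -/
structure IsIsometry (lam mu nu : ℝ) (φ : H31 ≃ H31) : Prop where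
  smooth : IsSmooth (fun z => (φ z).1)
  smooth_symm : IsSmooth (fun z => (φ.symm z).1)
  metric : ∀ z, ∀ u ∈ tangent z, ∀ v ∈ tangent z,
    metric lam mu nu (φ z) (dirD (fun y => (φ y).1) z u) (dirD (fun y => (φ y).1) z v)
      = metric lam mu nu z u v

/-- The topological group `G` acts continuously and by isometries of `g_{λμν}`. -/
structure ActsByIsometries (lam mu nu : ℝ) (G : Type*) [Group G] [TopologicalSpace G]
    [MulAction G H31] : Prop where
  continuous : ContinuousSMul G H31
  isometry : ∀ g : G, IsIsometry lam mu nu (MulAction.toPerm g)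

/-- An action is almost effective if the subgroup acting trivially is discrete. -/
def AlmostEffective (G : Type*) [Group G] [TopologicalSpace G] [MulAction G H31] : Prop :=
  DiscreteTopology (MulAction.toPermHom G H31).ker

/-! ### Lie algebras and reductive decompositions -/

instance : LieRing Mat := LieRing.ofAssociativeRing

/-- The Lie algebra `u(1,1)`. -/
def u11 : LieSubalgebra ℝ Mat where
  carrier := {B | Bᴴ * J + J * B = 0}
  add_mem' := by
    intro a b ha hb
    simp only [Set.mem_ofPred_eq] at *
    rw [Matrix.conjTranspose_add, add_mul, mul_add, add_add_add_comm, ha, hb, add_zero]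
  zero_mem' := by simp
  smul_mem' := by
    intro c a ha
    simp only [Set.mem_ofPred_eq] at *
    rw [Matrix.conjTranspose_smul, Matrix.smul_mul, Matrix.mul_smul, star_trivial, ← smul_add, ha,
      smul_zero]
  lie_mem' := by
    intro a b ha hb
    simp only [Set.mem_ofPred_eq] at *
    have ha' : aᴴ * J = -(J * a) := eq_neg_of_add_eq_zero_left ha
    have hb' : bᴴ * J = -(J * b) := eq_neg_of_add_eq_zero_left hb
    change (a * b - b * a)ᴴ * J + J * (a * b - b * a) = 0
    rw [Matrix.conjTranspose_sub, Matrix.conjTranspose_mul, Matrix.conjTranspose_mul, sub_mul,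
      Matrix.mul_assoc, Matrix.mul_assoc, ha', hb', mul_neg, mul_neg, ← Matrix.mul_assoc,
      ← Matrix.mul_assoc, ha', hb']
    noncomm_ring

/-- The Lie algebra `su(1,1)`. -/
def su11 : LieSubalgebra ℝ Mat where
  carrier := {B | B ∈ u11 ∧ B.trace = 0}
  add_mem' := fun ha hb => ⟨u11.add_mem ha.1 hb.1, by rw [Matrix.trace_add, ha.2, hb.2, add_zero]⟩
  zero_mem' := ⟨u11.zero_mem, by simp⟩
  smul_mem' := fun c _ ha =>
    ⟨u11.smul_mem c ha.1, by rw [Matrix.trace_smul, ha.2, smul_zero]⟩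
  lie_mem' := by
    intro a b ha hb
    refine ⟨u11.lie_mem ha.1 hb.1, ?_⟩
    change (a * b - b * a).trace = 0
    rw [Matrix.trace_sub, Matrix.trace_mul_comm, sub_self]

/-- The matrix exponential with values in the general linear group. -/
def expGL (B : Mat) : GL (Fin 2) ℂ := (Matrix.isUnit_exp B).unit

/-- `V` is the Lie algebra of the matrix group `G`. -/
def IsLieAlgebraOf (V : Submodule ℝ Mat) (G : Subgroup (GL (Fin 2) ℂ)) : Prop :=
  ∀ B : Mat, B ∈ V ↔ ∀ s : ℝ, expGL (s • B) ∈ G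

open Classical in
/-- The value at `z` of the vector field `B*` generated by the flow `s ↦ exp(sB)` of the action
of `G`, for `B` in the Lie algebra of `G`. -/
def fundamental (G : Subgroup (GL (Fin 2) ℂ)) [MulAction G H31] (B : Mat) (z : H31) : ℂ × ℂ :=
  deriv (fun s : ℝ =>
    if h : expGL (s • B) ∈ G then ((⟨expGL (s • B), h⟩ : G) • z).1 else 0) 0

/-- `𝔤 = m ⊕ h` is a reductive decomposition for the action of `G` with base point `o`: `𝔤` is the
Lie algebra of `G`, `h` is the Lie algebra of the isotropy group of `o`, and `m` is a complement of
`h` in `𝔤` that is invariant under the adjoint action of the isotropy group. -/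
structure IsReductiveDecomposition (G : Subgroup (GL (Fin 2) ℂ)) [MulAction G H31]
    (g : LieSubalgebra ℝ Mat) (m h : Submodule ℝ Mat) : Prop where
  lie_group : IsLieAlgebraOf g.toSubmodule G
  lie_isotropy : IsLieAlgebraOf h ((MulAction.stabilizer G o).map G.subtype)
  disjoint : m ⊓ h = ⊥
  span : m ⊔ h = g.toSubmodule
  ad_invariant : ∀ k ∈ MulAction.stabilizer G o, ∀ B ∈ m, k.1.1 * B * (k.1⁻¹).1 ∈ m

/-- The vector field `X'` is the push-forward of `X` under the action of `k`. -/
def IsPushforward {G : Type*} [Group G] [MulAction G H31] (k : G) (X X' : VF) : Prop :=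
  ∀ z, X'.1 (k • z) = dirD (fun y => (k • y : H31).1) z (X.1 z)

/-- `D` is the canonical connection of the reductive decomposition `𝔤 = m ⊕ h`: it is invariant
under `G`, and `D_{B*} C*` has the value `-([B,C]_m)*` at `o` for `B, C ∈ m`. -/
structure IsCanonicalConnection (G : Subgroup (GL (Fin 2) ℂ)) [MulAction G H31]
    (m h : Submodule ℝ Mat) (D : Connection) : Prop where
  invariant : ∀ (k : G) (X X' Y Y' : VF), IsPushforward k X X' → IsPushforward k Y Y' →
    IsPushforward k (D.cov X Y) (D.cov X' Y')
  value : ∀ B ∈ m, ∀ C ∈ m, ∀ P ∈ m, B * C - C * B - P ∈ h → ∀ X Y : VF,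
    (∀ z, X.1 z = fundamental G B z) → (∀ z, Y.1 z = fundamental G C z) →
      (D.cov X Y).1 o = - fundamental G P o

/-- The decomposition `𝔤 = m ⊕ h` is the one constructed from the tensor field `S` and the
connection `D = ∇ - S` with curvature `R`: there is a linear isomorphism `Φ` of `𝔤` onto the
direct sum of the holonomy algebra of `D` and `T_o`, which carries the bracket of `𝔤` to
`[U,V] = UV - VU`, `[U,x] = U x`, `[x,y] = S_x y - S_y x - R(x,y)`, carries `h` onto the holonomy
algebra and `m` onto `T_o`, and on `m` is the identification `B ↦ B*(o)`. -/
def IsConstructedFrom (G : Subgroup (GL (Fin 2) ℂ)) [MulAction G H31]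
    (g : LieSubalgebra ℝ Mat) (m h : Submodule ℝ Mat) (D : Connection) (S : Tensor12) : Prop :=
  ∃ Φ : g →ₗ[ℝ] Module.End ℝ (tangent o) × tangent o,
    Function.Injective Φ ∧
    LinearMap.range Φ = (D.holonomyAlgebra o).toSubmodule.prod ⊤ ∧
    (∀ B C : g, Φ ⁅B, C⁆ = modelBracket D S o (Φ B) (Φ C)) ∧
    (∀ B : g, B.1 ∈ h ↔ (Φ B).2 = 0) ∧
    (∀ B : g, B.1 ∈ m ↔ (Φ B).1 = 0) ∧
    (∀ B : g, B.1 ∈ m → ((Φ B).2 : ℂ × ℂ) = fundamental G B.1 o)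

/-- The decomposition `𝔤 = m ⊕ h` of the Lie algebra of `G` is a reductive decomposition which
induces, and is induced by, the tensor field `S`; here `D` is the Levi-Civita connection. -/
structure IsInducedDecomposition (G : Subgroup (GL (Fin 2) ℂ)) [MulAction G H31]
    (g : LieSubalgebra ℝ Mat) (m h : Submodule ℝ Mat) (D : Connection) (S : Tensor12) : Prop where
  reductive : IsReductiveDecomposition G g m h
  canonical : IsCanonicalConnection G m h (D.subTensor S)
  constructed : IsConstructedFrom G g m h (D.subTensor S) S

/-- The line spanned by `diag(0, i)`. -/
def hSpan : Submodule ℝ Mat := Submodule.span ℝ {!![0, 0; 0, Complex.I]}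

/-- The span of `diag(i, (1 + (λ - t)/μ) i)`, `X₁` and `X₂`. -/
def mSpan (lam mu t : ℝ) : Submodule ℝ Mat :=
  Submodule.span ℝ
    {!![Complex.I, 0; 0, ((1 + (lam - t) / mu : ℝ) : ℂ) * Complex.I],
      !![0, 1; 1, 0],
      !![0, Complex.I; -Complex.I, 0]}

end AdS

end

/-!
The proof is a computation in the left-invariant frame `X₀, X₁, X₂`, whose brackets are
`[X₀,X₁] = 2X₂`, `[X₁,X₂] = -2X₀`, `[X₂,X₀] = 2X₁` (`coord_bracket`). A vector field is determined
by its components in the frame, and vector fields act on functions as derivations with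
`[X,Y] f = X(Y f) - Y(X f)` (`derivAlong_bracket`), so that every identity between tensor fields
becomes an identity in a commutative ring.

Since `μ = ν`, the Koszul formula shows that the Levi-Civita connection is the connection with
parallel frame plus `S_λ(λ + 2μ)`. Hence `∇ - S_λ(t)` has parallel `X₀` and turns `X₁` into `X₂`
with angular velocity `κ θ⁰`, where `κ = (λ + 2μ - t)/μ` (`coord_sub_S12`). The metric, its curvature and
`S_λ(t)` have constant components that are invariant under rotations in the plane of `X₁, X₂`,
so they are parallel (`isHomogeneousStructure_S12`).

All three actions come from that of `U(1,1)` through the homomorphisms `psi` and `inclU`. An element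
`u` preserves `θ⁰` and multiplies `θ¹ + iθ²` by the constant `(det u)⁻¹` (`theta_actionCLM`), which
gives the invariance of the metric and of the connection. The Lie algebras are found by
differentiating the equations of the groups along one-parameter groups; in one direction this needs
`det (exp (sB)) = 1` for `tr B = 0`.

The complement `m` is the set of `B ∈ u(1,1)` with `tr B = κ B₀₀`, and with this condition the value
of the connection on fundamental fields at `o` is minus their bracket (`cov_fundamentalField_o`).
The curvature at `o` takes values in the multiples of the rotation `X₁ ↦ X₂ ↦ -X₁` and is nonzero
exactly when `κ ≠ 0` (`curvAt_sub_S12`); this separates the two cases. The isomorphism onto the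
model is `B ↦ (-c(B) • rotation, B*(o))`, where `c(B)` is the coefficient of `diag(0, i)` in
`u(1,1) = m ⊕ h` (`modelMap_lie`).
-/

noncomputable section

namespace AdS

/-! ### Differential calculus on `H31` -/

/-- The differential of the radial retraction is the identity on tangent vectors. -/
theorem dirD_coe (z : H31) {v : ℂ × ℂ} (hv : v ∈ tangent z) :
    dirD (fun y : H31 => y.1) z v = v := by
  have hd : DifferentiableAt ℝ (fun w => (radial w).1) z.1 :=
    (isSmooth_coe.contDiffAt (isOpen_cone.mem_nhds (mem_cone z))).differentiableAt (by simp)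
  have hc : HasDerivAt (fun s : ℝ => z.1 + s • v) v 0 := by
    simpa using ((hasDerivAt_id (0 : ℝ)).smul_const v).const_add z.1
  have hz : z.1 = z.1 + (0 : ℝ) • v := by simp
  -- Along `s ↦ z + s v` the form is `1 + s² quad v`, because `v` is orthogonal to `z`.
  have hquad : ∀ s : ℝ, quad (z.1 + s • v) = 1 + s ^ 2 * quad v := by
    intro s
    have h1 := z.2
    have h2 : bil z.1 v = 0 := hv
    simp [quad, bil, Complex.normSq_apply] at h1 h2 ⊢
    linear_combination h1 + 2 * s * h2
  have h1 : HasDerivAt (fun s : ℝ => (Real.sqrt (1 + s ^ 2 * quad v))⁻¹) 0 0 := by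
    have a : HasDerivAt (fun s : ℝ => 1 + s ^ 2 * quad v) 0 0 := by
      simpa using (((hasDerivAt_id (0 : ℝ)).pow 2).mul_const (quad v)).const_add 1
    have b := (a.sqrt (by simp)).inv (by simp)
    simpa [Pi.inv_def] using b
  have h2 : HasDerivAt (fun s : ℝ => (Real.sqrt (1 + s ^ 2 * quad v))⁻¹ • (z.1 + s • v)) v 0 := by
    have := HasDerivAt.fun_smul h1 hc
    simp only [zero_smul, add_zero] at this
    simpa [-smul_add] using this
  have h3 : HasDerivAt (fun s : ℝ => (radial (z.1 + s • v)).1) v 0 := by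
    refine h2.congr_of_eventuallyEq ?_
    have : ∀ᶠ s : ℝ in nhds 0, z.1 + s • v ∈ cone :=
      hc.continuousAt.eventually (by simpa using isOpen_cone.mem_nhds (mem_cone z))
    filter_upwards [this] with s hs
    rw [radial_of_mem hs, hquad]
  have h4 : HasFDerivAt (fun w => (radial w).1) (fderiv ℝ (fun w => (radial w).1) z.1)
      (z.1 + (0 : ℝ) • v) := by
    rw [← hz]; exact hd.hasFDerivAt
  have h5 := HasFDerivAt.comp_hasDerivAt (0 : ℝ) h4 hc
  exact HasDerivAt.unique h5 h3

theorem dirD_add_right {F : Type*} [NormedAddCommGroup F] [NormedSpace ℝ F] (f : H31 → F)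
    (z : H31) (u v : ℂ × ℂ) : dirD f z (u + v) = dirD f z u + dirD f z v := map_add _ _ _

theorem dirD_smul_right {F : Type*} [NormedAddCommGroup F] [NormedSpace ℝ F] (f : H31 → F)
    (z : H31) (c : ℝ) (v : ℂ × ℂ) : dirD f z (c • v) = c • dirD f z v := map_smul _ _ _

theorem IsSmooth.differentiableAt {F : Type*} [NormedAddCommGroup F] [NormedSpace ℝ F]
    {f : H31 → F} (hf : IsSmooth f) (z : H31) :
    DifferentiableAt ℝ (fun w => f (radial w)) z.1 :=
  (hf.contDiffAt (isOpen_cone.mem_nhds (mem_cone z))).differentiableAt (by simp)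

/-- The chain rule for the composition of a map on `H31` with a self-map of `H31`. -/
theorem dirD_comp {F : Type*} [NormedAddCommGroup F] [NormedSpace ℝ F] {f : H31 → F}
    (hf : IsSmooth f) {φ : H31 → H31} (hφ : IsSmooth (fun z => (φ z).1)) (z : H31) (v : ℂ × ℂ) :
    dirD (fun y => f (φ y)) z v = dirD f (φ z) (dirD (fun y => (φ y).1) z v) := by
  have h1 : (fun w => f (φ (radial w)))
      = (fun w => f (radial w)) ∘ (fun w => (φ (radial w)).1) := by
    funext w; simp [radial_coe]
  have e : (φ (radial z.1)).1 = (φ z).1 := by rw [radial_coe]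
  unfold dirD
  rw [h1, fderiv_comp _ (by rw [e]; exact hf.differentiableAt _) (hφ.differentiableAt z), e]
  rfl

/-- The chain rule for the restriction to `H31` of a map defined on `ℂ²`. -/
theorem dirD_comp_coe {F : Type*} [NormedAddCommGroup F] [NormedSpace ℝ F] {f : ℂ × ℂ → F}
    {z : H31} (hf : DifferentiableAt ℝ f z.1) {v : ℂ × ℂ} (hv : v ∈ tangent z) :
    dirD (fun y : H31 => f y.1) z v = fderiv ℝ f z.1 v := by
  have e : (radial z.1).1 = z.1 := by rw [radial_coe]
  have h1 : (fun w => f (radial w).1) = f ∘ (fun w => (radial w).1) := rfl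
  have := dirD_coe z hv
  unfold dirD at this ⊢
  rw [h1, fderiv_comp _ (by rw [e]; exact hf) (isSmooth_coe.differentiableAt z), e]
  simp [this]

/-- The differential of the restriction to `H31` of a real-linear map. -/
theorem dirD_linear {F : Type*} [NormedAddCommGroup F] [NormedSpace ℝ F] (L : ℂ × ℂ →L[ℝ] F)
    {z : H31} {v : ℂ × ℂ} (hv : v ∈ tangent z) : dirD (fun y : H31 => L y.1) z v = L v := by
  rw [dirD_comp_coe L.differentiableAt hv, L.fderiv]

/-! ### Derivations and the Lie bracket -/

theorem derivAlong_apply (X : VF) (f : SmoothFn) (z : H31) :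
    (derivAlong X f).1 z = dirD f.1 z (X.1 z) := rfl

theorem derivAlong_add (X : VF) (f g : SmoothFn) :
    derivAlong X (f + g) = derivAlong X f + derivAlong X g := by
  apply Subtype.ext; funext z
  have := fderiv_add (IsSmooth.differentiableAt f.2 z) (IsSmooth.differentiableAt g.2 z)
  exact congrArg (fun L => L (X.1 z)) this

theorem derivAlong_mul (X : VF) (f g : SmoothFn) :
    derivAlong X (f * g) = f * derivAlong X g + g * derivAlong X f := by
  apply Subtype.ext; funext z
  have := fderiv_mul (IsSmooth.differentiableAt f.2 z) (IsSmooth.differentiableAt g.2 z)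
  have h2 := congrArg (fun L => L (X.1 z)) this
  simp only [radial_coe] at h2
  exact h2

theorem derivAlong_algebraMap (X : VF) (c : ℝ) : derivAlong X (algebraMap ℝ SmoothFn c) = 0 :=
  Subtype.ext (funext fun z => dirD_const c z (X.1 z))

theorem derivAlong_smul (X : VF) (c : ℝ) (f : SmoothFn) :
    derivAlong X (c • f) = c • derivAlong X f := by
  rw [Algebra.smul_def, derivAlong_mul, derivAlong_algebraMap, mul_zero, add_zero,
    Algebra.smul_def]

theorem derivAlong_neg (X : VF) (f : SmoothFn) : derivAlong X (-f) = -derivAlong X f := by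
  rw [← neg_one_smul ℝ f, derivAlong_smul, neg_one_smul]

theorem derivAlong_sub (X : VF) (f g : SmoothFn) :
    derivAlong X (f - g) = derivAlong X f - derivAlong X g := by
  rw [sub_eq_add_neg, derivAlong_add, derivAlong_neg, sub_eq_add_neg]

theorem derivAlong_add_left (X Y : VF) (f : SmoothFn) :
    derivAlong (X + Y) f = derivAlong X f + derivAlong Y f :=
  Subtype.ext (funext fun z => dirD_add_right f.1 z (X.1 z) (Y.1 z))

theorem derivAlong_smul_left (g : SmoothFn) (X : VF) (f : SmoothFn) :
    derivAlong (g • X) f = g * derivAlong X f :=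
  Subtype.ext (funext fun z => dirD_smul_right f.1 z (g.1 z) (X.1 z))

/-- The second derivative of a function along two vector fields, in terms of the second
differential of its radially constant extension. -/
theorem derivAlong_derivAlong_apply (X Y : VF) (f : SmoothFn) (z : H31) :
    (derivAlong X (derivAlong Y f)).1 z
      = fderiv ℝ (fderiv ℝ (fun w => f.1 (radial w))) z.1 (X.1 z) (Y.1 z)
        + dirD f.1 z (dirD Y.1 z (X.1 z)) := by
  set G := fun w => f.1 (radial w) with hG
  have hGs : ContDiffOn ℝ ∞ (fderiv ℝ G) cone :=
    ContDiffOn.fderiv_of_isOpen f.2 isOpen_cone (by simp)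
  have hG1 : DifferentiableAt ℝ (fderiv ℝ G) (radial z.1).1 :=
    (hGs.contDiffAt (isOpen_cone.mem_nhds (mem_cone _))).differentiableAt (by simp)
  have hr := isSmooth_coe.differentiableAt z
  have e : (radial z.1).1 = z.1 := by rw [radial_coe]
  have h1 : DifferentiableAt ℝ (fun w => fderiv ℝ G (radial w).1) z.1 := hG1.comp z.1 hr
  have h2 := fderiv_clm_apply h1 (IsSmooth.differentiableAt Y.2.1 z)
  have h3 : fderiv ℝ (fun w => fderiv ℝ G (radial w).1) z.1 (X.1 z)
      = fderiv ℝ (fderiv ℝ G) z.1 (X.1 z) := by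
    have := fderiv_comp z.1 hG1 hr
    rw [e] at this
    have h4 := congrArg (fun L => L (X.1 z)) this
    have h5 := dirD_coe z (X.2.2 z)
    unfold dirD at h5
    simp only [ContinuousLinearMap.comp_apply, h5] at h4
    exact h4
  have h6 := congrArg (fun L => L (X.1 z)) h2
  simp only [radial_coe] at h6
  simp only [add_apply, ContinuousLinearMap.comp_apply,
    ContinuousLinearMap.flip_apply, h3] at h6
  rw [add_comm]
  exact h6

/-- The Lie bracket acts on functions as the commutator: the second differentials cancel by
symmetry. -/
theorem derivAlong_bracket (X Y : VF) (f : SmoothFn) :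
    derivAlong (bracket X Y) f = derivAlong X (derivAlong Y f) - derivAlong Y (derivAlong X f) := by
  apply Subtype.ext; funext z
  change _ = (derivAlong X (derivAlong Y f)).1 z - (derivAlong Y (derivAlong X f)).1 z
  rw [derivAlong_derivAlong_apply, derivAlong_derivAlong_apply]
  have hs : IsSymmSndFDerivAt ℝ (fun w => f.1 (radial w)) z.1 :=
    ContDiffAt.isSymmSndFDerivAt (n := ∞)
      (ContDiffOn.contDiffAt f.2 (isOpen_cone.mem_nhds (mem_cone z)))
      (by simp; exact ENat.LEInfty.out)
  rw [hs.eq (X.1 z) (Y.1 z), derivAlong_apply]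
  have : dirD f.1 z ((bracket X Y).1 z)
      = dirD f.1 z (dirD Y.1 z (X.1 z)) - dirD f.1 z (dirD X.1 z (Y.1 z)) := map_sub _ _ _
  rw [this]
  ring

theorem bracket_antisymm (X Y : VF) : bracket X Y = -bracket Y X := by
  apply Subtype.ext; funext z
  exact (neg_sub _ _).symm

theorem bracket_add_right (X Y Y' : VF) : bracket X (Y + Y') = bracket X Y + bracket X Y' := by
  apply Subtype.ext; funext z
  have h := fderiv_add (IsSmooth.differentiableAt Y.2.1 z) (IsSmooth.differentiableAt Y'.2.1 z)
  have h1 : dirD (Y + Y').1 z (X.1 z) = dirD Y.1 z (X.1 z) + dirD Y'.1 z (X.1 z) :=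
    congrArg (fun L => L (X.1 z)) h
  change dirD (Y + Y').1 z (X.1 z) - dirD X.1 z (Y.1 z + Y'.1 z)
    = dirD Y.1 z (X.1 z) - dirD X.1 z (Y.1 z) + (dirD Y'.1 z (X.1 z) - dirD X.1 z (Y'.1 z))
  rw [h1, dirD_add_right]
  abel

theorem bracket_smul_right (X : VF) (f : SmoothFn) (Y : VF) :
    bracket X (f • Y) = derivAlong X f • Y + f • bracket X Y := by
  apply Subtype.ext; funext z
  have h := fderiv_fun_smul (IsSmooth.differentiableAt f.2 z) (IsSmooth.differentiableAt Y.2.1 z)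
  have h1 : dirD (f • Y).1 z (X.1 z)
      = f.1 z • dirD Y.1 z (X.1 z) + dirD f.1 z (X.1 z) • Y.1 z := by
    have := congrArg (fun L => L (X.1 z)) h
    simp only [radial_coe] at this
    exact this
  change dirD (f • Y).1 z (X.1 z) - dirD X.1 z (f.1 z • Y.1 z)
    = dirD f.1 z (X.1 z) • Y.1 z + f.1 z • (dirD Y.1 z (X.1 z) - dirD X.1 z (Y.1 z))
  rw [h1, dirD_smul_right, smul_sub]
  abel

/-! ### Coordinates in the left-invariant frame -/

theorem sum_coord_frame (X : VF) : ∑ a, coord a X • frame a = X := by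
  apply Subtype.ext; funext z
  have h := sum_theta_frame z (X.1 z) (X.2.2 z)
  simp only [Fin.sum_univ_three] at h ⊢
  exact h

theorem ext_coord {X Y : VF} (h : ∀ a, coord a X = coord a Y) : X = Y := by
  rw [← sum_coord_frame X, ← sum_coord_frame Y]
  simp only [h]

theorem coord_neg (a : Fin 3) (X : VF) : coord a (-X) = -coord a X := by
  rw [← neg_one_smul SmoothFn X, coord_smul, neg_one_mul]

theorem coord_sub (a : Fin 3) (X Y : VF) : coord a (X - Y) = coord a X - coord a Y := by
  rw [sub_eq_add_neg, coord_add, coord_neg, sub_eq_add_neg]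

theorem dirD_frame (a : Fin 3) (z : H31) {v : ℂ × ℂ} (hv : v ∈ tangent z) :
    dirD (frame a).1 z v = ((toMat v * pauli a) 0 0, (toMat v * pauli a) 0 1) := by
  have key : ∃ L : ℂ × ℂ →L[ℝ] ℂ × ℂ, ∀ w,
      L w = ((toMat w * pauli a) 0 0, (toMat w * pauli a) 0 1) := by
    refine ⟨LinearMap.toContinuousLinearMap
      { toFun := fun w => ((toMat w * pauli a) 0 0, (toMat w * pauli a) 0 1)
        map_add' := ?_
        map_smul' := ?_ }, fun w => rfl⟩
    · intro x y
      fin_cases a <;> ext <;> simp [toMat, pauli, Matrix.mul_apply, Fin.sum_univ_two] <;> ring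
    · intro c x
      fin_cases a <;> ext <;> simp [toMat, pauli, Matrix.mul_apply, Fin.sum_univ_two, mul_assoc]
  obtain ⟨L, hL⟩ := key
  have : (frame a).1 = fun y : H31 => L y.1 := by
    funext y; rw [hL]; rfl
  rw [this, dirD_linear L hv, hL]

/-- The bracket of two left-invariant fields is given by the commutator of matrices. -/
theorem bracket_frame_apply (a b : Fin 3) (z : H31) :
    (bracket (frame a) (frame b)).1 z
      = ((toMat z.1 * (pauli a * pauli b - pauli b * pauli a)) 0 0,
         (toMat z.1 * (pauli a * pauli b - pauli b * pauli a)) 0 1) := by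
  change dirD (frame b).1 z ((frame a).1 z) - dirD (frame a).1 z ((frame b).1 z) = _
  rw [dirD_frame b z ((frame a).2.2 z), dirD_frame a z ((frame b).2.2 z)]
  change (((toMat (frameFun a z) * pauli b) 0 0, (toMat (frameFun a z) * pauli b) 0 1) : ℂ × ℂ)
    - ((toMat (frameFun b z) * pauli a) 0 0, (toMat (frameFun b z) * pauli a) 0 1) = _
  rw [toMat_frameFun, toMat_frameFun, Matrix.mul_assoc, Matrix.mul_assoc, mul_sub]
  rfl

theorem bracket_frame_zero_one : bracket (frame 0) (frame 1) = (2 : SmoothFn) • frame 2 := by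
  apply Subtype.ext; funext z
  rw [bracket_frame_apply]
  change _ = (2 : ℝ) • frameFun 2 z
  apply Prod.ext <;>
    simp [frameFun, toMat, pauli, Matrix.mul_apply, Fin.sum_univ_two] <;> ring

theorem bracket_frame_one_two : bracket (frame 1) (frame 2) = (-2 : SmoothFn) • frame 0 := by
  apply Subtype.ext; funext z
  rw [bracket_frame_apply]
  change _ = (-2 : ℝ) • frameFun 0 z
  apply Prod.ext <;>
    simp [frameFun, toMat, pauli, Matrix.mul_apply, Fin.sum_univ_two] <;> ring

theorem bracket_frame_two_zero : bracket (frame 2) (frame 0) = (2 : SmoothFn) • frame 1 := by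
  apply Subtype.ext; funext z
  rw [bracket_frame_apply]
  change _ = (2 : ℝ) • frameFun 1 z
  apply Prod.ext <;>
    simp [frameFun, toMat, pauli, Matrix.mul_apply, Fin.sum_univ_two] <;> ring

theorem bracket_self (X : VF) : bracket X X = 0 := by
  apply Subtype.ext; funext z
  exact sub_self _

/-- The bracket in terms of the components of the fields and the brackets of the frame. -/
theorem bracket_eq (X Y : VF) :
    bracket X Y = ∑ a, (derivAlong X (coord a Y) - derivAlong Y (coord a X)) • frame a
      + ∑ b, ∑ a, (coord b X * coord a Y) • bracket (frame b) (frame a) := by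
  have h1 : ∀ X Y : VF, bracket X Y
      = ∑ a, (derivAlong X (coord a Y) • frame a + coord a Y • bracket X (frame a)) := by
    intro X Y
    nth_rewrite 1 [← sum_coord_frame Y]
    simp only [Fin.sum_univ_three, bracket_add_right, bracket_smul_right]
  have h2 : ∀ a, bracket X (frame a) = ∑ b, (-derivAlong (frame a) (coord b X) • frame b
      + coord b X • bracket (frame b) (frame a)) := by
    intro a
    rw [bracket_antisymm, h1]
    rw [← Finset.sum_neg_distrib]
    refine Finset.sum_congr rfl fun b _ => ?_
    rw [bracket_antisymm (frame b) (frame a), smul_neg, neg_smul, neg_add]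
  have h3 : ∀ b, derivAlong Y (coord b X)
      = ∑ a, coord a Y * derivAlong (frame a) (coord b X) := by
    intro b
    nth_rewrite 1 [← sum_coord_frame Y]
    simp only [Fin.sum_univ_three, derivAlong_add_left, derivAlong_smul_left]
  rw [h1]
  simp only [h2, h3, Fin.sum_univ_three]
  module

/-- The components of the Lie bracket, for the structure constants
`[X₀,X₁] = 2X₂`, `[X₁,X₂] = -2X₀`, `[X₂,X₀] = 2X₁`. -/
theorem coord_bracket (X Y : VF) :
    coord 0 (bracket X Y) = derivAlong X (coord 0 Y) - derivAlong Y (coord 0 X)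
        - 2 * (coord 1 X * coord 2 Y - coord 2 X * coord 1 Y) ∧
    coord 1 (bracket X Y) = derivAlong X (coord 1 Y) - derivAlong Y (coord 1 X)
        + 2 * (coord 2 X * coord 0 Y - coord 0 X * coord 2 Y) ∧
    coord 2 (bracket X Y) = derivAlong X (coord 2 Y) - derivAlong Y (coord 2 X)
        + 2 * (coord 0 X * coord 1 Y - coord 1 X * coord 0 Y) := by
  have e10 := bracket_antisymm (frame 1) (frame 0)
  have e21 := bracket_antisymm (frame 2) (frame 1)
  have e02 := bracket_antisymm (frame 0) (frame 2)
  have c0 : ∀ a, coord a (0 : VF) = 0 := fun a => by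
    have := coord_smul a 0 (0 : VF); rwa [zero_smul, zero_mul] at this
  refine ⟨?_, ?_, ?_⟩ <;>
  · nth_rewrite 1 [bracket_eq]
    simp only [Fin.sum_univ_three, e10, e21, e02, bracket_self, bracket_frame_zero_one,
      bracket_frame_one_two, bracket_frame_two_zero, coord_add, coord_smul, coord_neg, c0,
      coord_frame]
    simp
    ring

/-! ### The Levi-Civita connection and the connection `∇ - S` in the frame -/

/-- The connection for which the left-invariant fields `X₀, X₁, X₂` are parallel. -/
def flatConnection : Connection where
  cov X Y := ∑ a, derivAlong X (coord a Y) • frame a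
  add_left X X' Y := by
    simp only [derivAlong_add_left, add_smul, Finset.sum_add_distrib]
  smul_left f X Y := by
    simp only [derivAlong_smul_left, Finset.smul_sum, smul_smul]
  add_right X Y Y' := by
    simp only [coord_add, derivAlong_add, add_smul, Finset.sum_add_distrib]
  leibniz X f Y := by
    nth_rewrite 2 [← sum_coord_frame Y]
    simp only [coord_smul, derivAlong_mul, Finset.smul_sum, smul_smul, add_smul,
      Finset.sum_add_distrib]
    rw [add_comm]
    simp only [mul_comm]

/-- The Levi-Civita connection of `g_{λμμ}`, as the sum of the connection with parallel
left-invariant fields and the tensor `S_λ(λ + 2μ)`. -/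
def leviCivita (lam mu : ℝ) : Connection where
  cov X Y := flatConnection.cov X Y + (S12 lam mu mu (lam + 2 * mu)).app X Y
  add_left X X' Y := by rw [Connection.add_left, Tensor12.add_left]; abel
  smul_left f X Y := by rw [Connection.smul_left, Tensor12.smul_left, smul_add]
  add_right X Y Y' := by rw [Connection.add_right, Tensor12.add_right]; abel
  leibniz X f Y := by rw [Connection.leibniz, Tensor12.smul_right, smul_add]; abel

theorem coord_flatConnection (a : Fin 3) (X Y : VF) :
    coord a (flatConnection.cov X Y) = derivAlong X (coord a Y) := by
  simp only [flatConnection, Fin.sum_univ_three, coord_add, coord_smul, coord_frame]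
  fin_cases a <;> simp

theorem coord_S12 (lam mu t : ℝ) (hlam : lam ≠ 0) (X Y : VF) :
    coord 0 ((S12 lam mu mu t).app X Y) = coord 2 X * coord 1 Y - coord 1 X * coord 2 Y ∧
    coord 1 ((S12 lam mu mu t).app X Y)
      = -((lam / mu) • (coord 2 X * coord 0 Y)) - (t / mu) • (coord 0 X * coord 2 Y) ∧
    coord 2 ((S12 lam mu mu t).app X Y)
      = (t / mu) • (coord 0 X * coord 1 Y) + (lam / mu) • (coord 1 X * coord 0 Y) := by
  have c : ∀ a, coord a ((S12 lam mu mu t).app X Y)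
      = (![lam, mu, mu] a)⁻¹ • S03 lam t X Y (frame a) := by
    intro a
    simp only [S12, Fin.sum_univ_three, coord_add, coord_smul, coord_frame]
    fin_cases a <;> simp
  refine ⟨?_, ?_, ?_⟩
  · rw [c]
    simp only [S03, wedge, coord_frame]
    simp
    rw [← smul_sub, smul_smul, inv_mul_cancel₀ hlam, one_smul]
  · rw [c]
    simp only [S03, wedge, coord_frame]
    simp [smul_smul, div_eq_inv_mul, sub_eq_add_neg]
  · rw [c]
    simp only [S03, wedge, coord_frame]
    simp [smul_add, smul_smul, div_eq_inv_mul]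

theorem coord_leviCivita (lam mu : ℝ) (hlam : lam ≠ 0) (hmu : mu ≠ 0) (X Y : VF) :
    coord 0 ((leviCivita lam mu).cov X Y)
      = derivAlong X (coord 0 Y) + (coord 2 X * coord 1 Y - coord 1 X * coord 2 Y) ∧
    coord 1 ((leviCivita lam mu).cov X Y)
      = derivAlong X (coord 1 Y) - (lam / mu) • (coord 2 X * coord 0 Y)
        - (lam / mu + 2) • (coord 0 X * coord 2 Y) ∧
    coord 2 ((leviCivita lam mu).cov X Y)
      = derivAlong X (coord 2 Y) + (lam / mu + 2) • (coord 0 X * coord 1 Y)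
        + (lam / mu) • (coord 1 X * coord 0 Y) := by
  obtain ⟨h0, h1, h2⟩ := coord_S12 lam mu (lam + 2 * mu) hlam X Y
  have e : (lam + 2 * mu) / mu = lam / mu + 2 := by field_simp
  rw [e] at h1 h2
  simp only [leviCivita, coord_add, coord_flatConnection, h0, h1, h2]
  refine ⟨trivial, ?_, ?_⟩ <;> abel

/-- The connection `∇ - S_λ(t)` differs from the one with parallel left-invariant fields by a
rotation of `X₁, X₂` with angular velocity `κ θ⁰`, where `κ = (λ + 2μ - t)/μ`. -/
theorem coord_sub_S12 (lam mu t : ℝ) (hlam : lam ≠ 0) (hmu : mu ≠ 0) (X Y : VF) :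
    coord 0 (((leviCivita lam mu).subTensor (S12 lam mu mu t)).cov X Y)
      = derivAlong X (coord 0 Y) ∧
    coord 1 (((leviCivita lam mu).subTensor (S12 lam mu mu t)).cov X Y)
      = derivAlong X (coord 1 Y) - ((lam + 2 * mu - t) / mu) • (coord 0 X * coord 2 Y) ∧
    coord 2 (((leviCivita lam mu).subTensor (S12 lam mu mu t)).cov X Y)
      = derivAlong X (coord 2 Y) + ((lam + 2 * mu - t) / mu) • (coord 0 X * coord 1 Y) := by
  obtain ⟨h0, h1, h2⟩ := coord_leviCivita lam mu hlam hmu X Y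
  obtain ⟨s0, s1, s2⟩ := coord_S12 lam mu t hlam X Y
  have e : (lam + 2 * mu - t) / mu = lam / mu + 2 - t / mu := by field_simp
  rw [e]
  simp only [Connection.subTensor, coord_sub, h0, h1, h2, s0, s1, s2]
  refine ⟨?_, ?_, ?_⟩ <;> module

theorem leviCivita_isLeviCivita (lam mu : ℝ) (hlam : lam ≠ 0) (hmu : mu ≠ 0) :
    (leviCivita lam mu).IsLeviCivita lam mu mu := by
  have hr : algebraMap ℝ SmoothFn lam
      = algebraMap ℝ SmoothFn mu * algebraMap ℝ SmoothFn (lam / mu) := by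
    rw [← map_mul]; congr 1; field_simp
  constructor
  · intro X Y Z
    obtain ⟨h0, h1, h2⟩ := coord_leviCivita lam mu hlam hmu X Y
    obtain ⟨k0, k1, k2⟩ := coord_leviCivita lam mu hlam hmu X Z
    simp only [metricFn, derivAlong_add, derivAlong_smul, derivAlong_mul, h0, h1, h2, k0, k1, k2]
    simp only [Algebra.smul_def, hr, map_add, map_ofNat]
    ring
  · intro X Y
    obtain ⟨h0, h1, h2⟩ := coord_leviCivita lam mu hlam hmu X Y
    obtain ⟨k0, k1, k2⟩ := coord_leviCivita lam mu hlam hmu Y X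
    obtain ⟨b0, b1, b2⟩ := coord_bracket X Y
    apply ext_coord
    intro a
    rw [coord_sub]
    fin_cases a
    · simp only [Fin.zero_eta, h0, k0, b0]
      ring
    · simp only [Fin.mk_one, h1, k1, b1, Algebra.smul_def, map_add, map_ofNat]
      ring
    · simp only [Fin.reduceFinMk, h2, k2, b2, Algebra.smul_def, map_add, map_ofNat]
      ring

/-- The components of the curvature tensor of `g_{λμμ}`. -/
theorem coord_curv_leviCivita (lam mu : ℝ) (hlam : lam ≠ 0) (hmu : mu ≠ 0) (X Y Z : VF) :
    coord 0 ((leviCivita lam mu).curv X Y Z)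
      = (lam / mu) • ((coord 0 X * coord 1 Y - coord 1 X * coord 0 Y) * coord 1 Z
        + (coord 0 X * coord 2 Y - coord 2 X * coord 0 Y) * coord 2 Z) ∧
    coord 1 ((leviCivita lam mu).curv X Y Z)
      = -((lam / mu) ^ 2) • ((coord 0 X * coord 1 Y - coord 1 X * coord 0 Y) * coord 0 Z)
        - (4 + 3 * (lam / mu)) • ((coord 1 X * coord 2 Y - coord 2 X * coord 1 Y) * coord 2 Z) ∧
    coord 2 ((leviCivita lam mu).curv X Y Z)
      = -((lam / mu) ^ 2) • ((coord 0 X * coord 2 Y - coord 2 X * coord 0 Y) * coord 0 Z)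
        + (4 + 3 * (lam / mu)) • ((coord 1 X * coord 2 Y - coord 2 X * coord 1 Y) * coord 1 Z) := by
  have h := fun X Y => coord_leviCivita lam mu hlam hmu X Y
  have h0 := fun X Y => (h X Y).1
  have h1 := fun X Y => (h X Y).2.1
  have h2 := fun X Y => (h X Y).2.2
  obtain ⟨b0, b1, b2⟩ := coord_bracket X Y
  simp only [Connection.curv, coord_sub, h0, h1, h2, b0, b1, b2, derivAlong_add, derivAlong_sub,
    derivAlong_smul, derivAlong_mul, derivAlong_bracket]
  simp only [Algebra.smul_def, map_add, map_neg, map_pow, map_mul, map_ofNat]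
  refine ⟨?_, ?_, ?_⟩ <;> ring

/-- All tensors involved have constant components in the frame and are invariant under the
rotations of `X₁, X₂`, so they are parallel for `∇ - S`. -/
theorem isHomogeneousStructure_S12 (lam mu t : ℝ) (hlam : lam ≠ 0) (hmu : mu ≠ 0) :
    IsHomogeneousStructure lam mu mu (leviCivita lam mu) (S12 lam mu mu t) := by
  have h := fun X Y => coord_sub_S12 lam mu t hlam hmu X Y
  have h0 := fun X Y => (h X Y).1
  have h1 := fun X Y => (h X Y).2.1
  have h2 := fun X Y => (h X Y).2.2
  have r := fun X Y Z => coord_curv_leviCivita lam mu hlam hmu X Y Z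
  have r0 := fun X Y Z => (r X Y Z).1
  have r1 := fun X Y Z => (r X Y Z).2.1
  have r2 := fun X Y Z => (r X Y Z).2.2
  have s := fun X Y => coord_S12 lam mu t hlam X Y
  have s0 := fun X Y => (s X Y).1
  have s1 := fun X Y => (s X Y).2.1
  have s2 := fun X Y => (s X Y).2.2
  refine ⟨?_, ?_, ?_⟩
  · intro X Y Z
    simp only [metricFn, derivAlong_add, derivAlong_smul, derivAlong_mul, h0, h1, h2]
    simp only [Algebra.smul_def]
    ring
  · intro X Y Z W
    apply ext_coord
    intro a
    fin_cases a <;>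
      simp only [Fin.zero_eta, Fin.mk_one, Fin.reduceFinMk, coord_add, h0, h1, h2, r0, r1, r2,
        derivAlong_add, derivAlong_sub, derivAlong_smul, derivAlong_mul] <;>
      simp only [Algebra.smul_def] <;> ring
  · intro X Y Z
    apply ext_coord
    intro a
    fin_cases a <;>
      simp only [Fin.zero_eta, Fin.mk_one, Fin.reduceFinMk, coord_add, h0, h1, h2, s0, s1, s2,
        derivAlong_add, derivAlong_sub, derivAlong_smul, derivAlong_mul, derivAlong_neg] <;>
      simp only [Algebra.smul_def] <;> ring

/-- The components of the curvature of `∇ - S_λ(t)`. -/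
theorem coord_curv_sub_S12 (lam mu t : ℝ) (hlam : lam ≠ 0) (hmu : mu ≠ 0) (X Y Z : VF) :
    coord 0 (((leviCivita lam mu).subTensor (S12 lam mu mu t)).curv X Y Z) = 0 ∧
    coord 1 (((leviCivita lam mu).subTensor (S12 lam mu mu t)).curv X Y Z)
      = -(2 * ((lam + 2 * mu - t) / mu)) •
        ((coord 1 X * coord 2 Y - coord 2 X * coord 1 Y) * coord 2 Z) ∧
    coord 2 (((leviCivita lam mu).subTensor (S12 lam mu mu t)).curv X Y Z)
      = (2 * ((lam + 2 * mu - t) / mu)) •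
        ((coord 1 X * coord 2 Y - coord 2 X * coord 1 Y) * coord 1 Z) := by
  have h := fun X Y => coord_sub_S12 lam mu t hlam hmu X Y
  have h0 := fun X Y => (h X Y).1
  have h1 := fun X Y => (h X Y).2.1
  have h2 := fun X Y => (h X Y).2.2
  obtain ⟨b0, -, -⟩ := coord_bracket X Y
  simp only [Connection.curv, coord_sub, h0, h1, h2, b0, derivAlong_add, derivAlong_sub,
    derivAlong_smul, derivAlong_mul, derivAlong_bracket]
  simp only [Algebra.smul_def, map_neg, map_mul, map_ofNat]
  refine ⟨?_, ?_, ?_⟩ <;> ring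

/-! ### The group actions -/

theorem toMat_injective : Function.Injective toMat := by
  intro z w h
  have h0 := congrFun (congrFun h 0) 0
  have h1 := congrFun (congrFun h 0) 1
  exact Prod.ext (by simpa [toMat] using h0) (by simpa [toMat] using h1)

theorem toMat_smul_SU11 (A : SU11) (z : H31) : toMat (A • z).1 = A.1.1 * toMat z.1 := by
  change toMat (toSU.symm (A * toSU z)).1 = _
  rw [toMat_symm]
  rfl

theorem toMat_smul_prod (A : SU11) (w : Circle) (z : H31) :
    toMat ((A, w) • z).1 = A.1.1 * toMat z.1 * !![(w : ℂ)⁻¹, 0; 0, (w : ℂ)] := by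
  change toMat (toSU.symm (A * toSU z * (diagHom w)⁻¹)).1 = _
  rw [toMat_symm, ← map_inv]
  change A.1.1 * toMat z.1 * toMat (((w⁻¹ : Circle) : ℂ), 0) = _
  congr 1
  ext i j
  fin_cases i <;> fin_cases j <;> simp [toMat, ← Circle.coe_inv_eq_conj]

theorem toMat_smul_U11 (u : U11) (z : H31) :
    toMat (u • z).1 = u.1.1 * toMat z.1 * !![1, 0; 0, (u.1.1.det)⁻¹] := by
  change toMat (toSU.symm (uMul u (toSU z))).1 = _
  rw [toMat_symm]
  change u.1.1 * toMat z.1 * (((detHom u)⁻¹ : U11).1.1) = _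
  congr 1
  have h : ((detHom u)⁻¹ : U11).1.1 * (detHom u).1.1 = 1 := (detHom u).1.inv_mul
  have hd : u.1.1.det ≠ 0 := fun h0 => by simpa [h0] using U11_det u
  have h2 : (detHom u).1.1 * !![1, 0; 0, (u.1.1.det)⁻¹] = 1 := by
    rw [detHom_val]
    ext i j
    fin_cases i <;> fin_cases j <;> simp [Matrix.mul_apply, Fin.sum_univ_two, hd]
  exact left_inv_eq_right_inv h h2

theorem psi_val (p : SU11 × Circle) : (psi p).1.1 = (p.2 : ℂ)⁻¹ • p.1.1.1 := rfl

theorem psi_smul (p : SU11 × Circle) (z : H31) : psi p • z = p • z := by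
  apply Subtype.ext
  apply toMat_injective
  obtain ⟨A, w⟩ := p
  have hA := SU11_det A
  rw [toMat_smul_U11, toMat_smul_prod, psi_val, Matrix.det_smul, hA, Matrix.smul_mul,
    Matrix.smul_mul, ← Matrix.mul_smul]
  congr 1
  have hw : (w : ℂ) ≠ 0 := w.coe_ne_zero
  ext i j
  fin_cases i <;> fin_cases j <;> simp [hw, pow_two]

theorem inclU_val (A : SU11) : (inclU A).1.1 = A.1.1 := rfl

theorem inclU_smul (A : SU11) (z : H31) : inclU A • z = A • z := by
  apply Subtype.ext
  apply toMat_injective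
  rw [toMat_smul_U11, toMat_smul_SU11, inclU_val, SU11_det, inv_one]
  have : (!![1, 0; 0, 1] : Mat) = 1 := by
    ext i j
    fin_cases i <;> fin_cases j <;> simp
  rw [this, mul_one]

theorem psi_surjective : Function.Surjective psi := by
  intro u
  have hn : ‖u.1.1.det‖ = 1 := by
    have h := U11_det u
    rw [RCLike.star_def, Complex.mul_conj, Complex.normSq_eq_norm_sq] at h
    have h' : ‖u.1.1.det‖ ^ 2 = 1 := by exact_mod_cast h
    exact (pow_eq_one_iff_of_nonneg (norm_nonneg _) two_ne_zero).mp h'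
  -- A square root `w` of `(det u)⁻¹`.
  obtain ⟨w, hw⟩ : ∃ w : Circle, (w : ℂ) * w * u.1.1.det = 1 := by
    refine ⟨Circle.exp (-Complex.arg u.1.1.det / 2), ?_⟩
    rw [← Circle.coe_mul, ← Circle.exp_add, Circle.coe_exp]
    nth_rewrite 3 [← Complex.norm_mul_exp_arg_mul_I u.1.1.det]
    rw [hn, Complex.ofReal_one, one_mul, ← Complex.exp_add, ← Complex.exp_zero]
    congr 1
    push_cast
    ring
  set s : U11 := psi (1, w) with hs
  have hsv : s.1.1 = (w : ℂ)⁻¹ • (1 : Mat) := rfl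
  have hsi : (s⁻¹).1.1 = (w : ℂ) • (1 : Mat) := by
    have h1 : (s⁻¹).1.1 * s.1.1 = 1 := s.1.inv_mul
    refine left_inv_eq_right_inv h1 ?_
    rw [hsv, smul_mul_smul_comm, inv_mul_cancel₀ w.coe_ne_zero, one_smul, mul_one]
  have hdet : Matrix.GeneralLinearGroup.det (u * s⁻¹).1 = 1 := by
    apply Units.ext
    change (u.1.1 * (s⁻¹).1.1).det = 1
    rw [Matrix.det_mul, hsi, Matrix.det_smul]
    simp only [Fintype.card_fin, Matrix.det_one, mul_one]
    rw [← hw]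
    ring
  set A : SU11 := ⟨(u * s⁻¹).1, (u * s⁻¹).2, hdet⟩
  refine ⟨(A, w), ?_⟩
  have h1 : ((A, w) : SU11 × Circle) = (A, 1) * (1, w) := by simp
  have h2 : psi (A, 1) = u * s⁻¹ := by
    apply Subtype.ext
    apply Units.ext
    rw [psi_val]
    simp [A]
  rw [h1, map_mul, h2, ← hs, inv_mul_cancel_right]

theorem U11_row (u : U11) :
    u.1.1 0 0 * star (u.1.1 0 0) - u.1.1 0 1 * star (u.1.1 0 1) = 1 := by
  have hu : u.1.1ᴴ * J * u.1.1 = J := u.2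
  have hJ : J * J = 1 := by
    ext i j
    fin_cases i <;> fin_cases j <;> simp [J, Matrix.mul_apply, Fin.sum_univ_two]
  have h1 : (J * u.1.1ᴴ * J) * u.1.1 = 1 := by
    rw [Matrix.mul_assoc, Matrix.mul_assoc, ← Matrix.mul_assoc (u.1.1ᴴ), hu, hJ]
  have h3 : u.1.1 * (J * u.1.1ᴴ * J) = 1 := mul_eq_one_comm.mp h1
  have h2 := congrFun (congrFun h3 0) 0
  simp only [Matrix.mul_apply, Fin.sum_univ_two, Matrix.conjTranspose_apply] at h2
  simp [J] at h2
  simp only [RCLike.star_def]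
  linear_combination h2

/-- The real-linear map of `ℂ²` that restricts to the action of `u ∈ U(1,1)` on `H31`. -/
def actionCLM (u : U11) : ℂ × ℂ →L[ℝ] ℂ × ℂ :=
  LinearMap.toContinuousLinearMap
    { toFun := fun w => (u.1.1 0 0 * w.1 + u.1.1 0 1 * star w.2,
        (u.1.1.det)⁻¹ * (u.1.1 0 0 * w.2 + u.1.1 0 1 * star w.1))
      map_add' := fun x y => by
        ext <;> simp <;> ring
      map_smul' := fun c x => by
        ext <;> simp <;> ring }

theorem actionCLM_apply (u : U11) (w : ℂ × ℂ) :
    actionCLM u w = (u.1.1 0 0 * w.1 + u.1.1 0 1 * star w.2,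
        (u.1.1.det)⁻¹ * (u.1.1 0 0 * w.2 + u.1.1 0 1 * star w.1)) := rfl

theorem smul_U11_val (u : U11) (z : H31) : (u • z).1 = actionCLM u z.1 := by
  have h := toMat_smul_U11 u z
  have h0 := congrFun (congrFun h 0) 0
  have h1 := congrFun (congrFun h 0) 1
  simp [toMat, Matrix.mul_apply, Fin.sum_univ_two] at h0 h1
  rw [actionCLM_apply]
  refine Prod.ext ?_ ?_
  · simpa using h0
  · simp only [h1, RCLike.star_def]
    ring

theorem isSmooth_smul_U11 (u : U11) : IsSmooth (fun z => (u • z : H31).1) := by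
  simp only [smul_U11_val]
  exact isSmooth_comp_coe (actionCLM u).contDiff

theorem dirD_smul_U11 (u : U11) {z : H31} {v : ℂ × ℂ} (hv : v ∈ tangent z) :
    dirD (fun y => (u • y : H31).1) z v = actionCLM u v := by
  simp only [smul_U11_val]
  exact dirD_linear (actionCLM u) hv

/-- The complex number `θ¹(v) + i θ²(v)`. -/
def thetaC (z v : ℂ × ℂ) : ℂ := star z.1 * v.2 - z.2 * star v.1

theorem theta_one (z : H31) (v : ℂ × ℂ) : theta 1 z v = (thetaC z.1 v).re := rfl

theorem theta_two (z : H31) (v : ℂ × ℂ) : theta 2 z v = (thetaC z.1 v).im := rfl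

theorem theta_zero_actionCLM (u : U11) (z : H31) (v : ℂ × ℂ) :
    theta 0 (u • z) (actionCLM u v) = theta 0 z v := by
  have h1 := U11_row u
  have h2 : (u.1.1.det)⁻¹ * star (u.1.1.det)⁻¹ = 1 := by
    rw [star_inv₀, ← mul_inv, U11_det, inv_one]
  change (star (u • z : H31).1.1 * (actionCLM u v).1
    - (u • z : H31).1.2 * star (actionCLM u v).2).im = (star z.1.1 * v.1 - z.1.2 * star v.2).im
  congr 1
  rw [smul_U11_val]
  simp only [actionCLM_apply, star_add, star_mul', star_star]
  linear_combination (star z.1.1 * v.1 - z.1.2 * star v.2) * h1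
    - (u.1.1 0 0 * z.1.2 + u.1.1 0 1 * star z.1.1)
      * (star (u.1.1 0 0) * star v.2 + star (u.1.1 0 1) * v.1) * h2

theorem thetaC_actionCLM (u : U11) (z v : ℂ × ℂ) :
    thetaC (actionCLM u z) (actionCLM u v) = (u.1.1.det)⁻¹ * thetaC z v := by
  have h1 := U11_row u
  simp only [thetaC, actionCLM_apply, star_add, star_mul', star_star]
  linear_combination (u.1.1.det)⁻¹ * (star z.1 * v.2 - z.2 * star v.1) * h1

/-- The action of `u` preserves `θ⁰` and rotates `(θ¹, θ²)` by the constant `(det u)⁻¹`. -/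
theorem theta_actionCLM (u : U11) (z : H31) (v : ℂ × ℂ) :
    theta 0 (u • z) (actionCLM u v) = theta 0 z v ∧
    theta 1 (u • z) (actionCLM u v)
      = (u.1.1.det)⁻¹.re * theta 1 z v - (u.1.1.det)⁻¹.im * theta 2 z v ∧
    theta 2 (u • z) (actionCLM u v)
      = (u.1.1.det)⁻¹.re * theta 2 z v + (u.1.1.det)⁻¹.im * theta 1 z v := by
  refine ⟨theta_zero_actionCLM u z v, ?_, ?_⟩
  · rw [theta_one, smul_U11_val, thetaC_actionCLM, Complex.mul_re]
    rfl
  · rw [theta_two, smul_U11_val, thetaC_actionCLM, Complex.mul_im]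
    rfl

theorem det_inv_re_im (u : U11) :
    (u.1.1.det)⁻¹.re * (u.1.1.det)⁻¹.re + (u.1.1.det)⁻¹.im * (u.1.1.det)⁻¹.im = 1 := by
  have h2 : (u.1.1.det)⁻¹ * star (u.1.1.det)⁻¹ = 1 := by
    rw [star_inv₀, ← mul_inv, U11_det, inv_one]
  rw [RCLike.star_def, Complex.mul_conj, Complex.normSq_apply] at h2
  exact_mod_cast h2

/-- The action preserves the form `bil`, so that it maps tangent vectors to tangent vectors. -/
theorem bil_actionCLM (u : U11) (z v : ℂ × ℂ) : bil (actionCLM u z) (actionCLM u v) = bil z v := by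
  have h1 := U11_row u
  have h2 : (u.1.1.det)⁻¹ * star (u.1.1.det)⁻¹ = 1 := by
    rw [star_inv₀, ← mul_inv, U11_det, inv_one]
  set x := star z.1 * v.1 - star z.2 * v.2 with hx
  set q := star (u.1.1 0 0) * u.1.1 0 1 * (star z.1 * star v.2 - star z.2 * star v.1) with hq
  have hB : (u.1.1 0 1 * star (u.1.1 0 1)).im = 0 := by
    simp only [RCLike.star_def, Complex.mul_conj, Complex.ofReal_im]
  have key : star (actionCLM u z).1 * (actionCLM u v).1 - star (actionCLM u z).2 * (actionCLM u v).2
      = x + u.1.1 0 1 * star (u.1.1 0 1) * (x - star x) + (q - star q) := by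
    simp only [actionCLM_apply, hx, hq, star_add, star_sub, star_mul', star_star]
    linear_combination (star z.1 * v.1 - star z.2 * v.2) * h1
      - (star (u.1.1 0 0) * star z.2 + star (u.1.1 0 1) * z.1)
        * (u.1.1 0 0 * v.2 + u.1.1 0 1 * star v.1) * h2
  have e : ∀ y : ℂ, (y - star y).re = 0 := fun y => by simp
  change (star (actionCLM u z).1 * (actionCLM u v).1
    - star (actionCLM u z).2 * (actionCLM u v).2).re = x.re
  rw [key, Complex.add_re, Complex.add_re, Complex.mul_re, hB, e, e]
  ring

theorem actsByIsometries_U11 (lam mu : ℝ) : ActsByIsometries lam mu mu U11 where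
  continuous := by
    constructor
    apply Continuous.subtype_mk (f := fun p : U11 × H31 => (p.1 • p.2 : H31).1)
    simp only [smul_U11_val, actionCLM_apply]
    have hm : Continuous fun p : U11 × H31 => p.1.1.1 :=
      Units.continuous_val.comp (continuous_subtype_val.comp continuous_fst)
    have he : ∀ i j, Continuous fun p : U11 × H31 => p.1.1.1 i j := fun i j =>
      hm.matrix_elem i j
    have hz : Continuous fun p : U11 × H31 => p.2.1 := continuous_subtype_val.comp continuous_snd
    have hd : Continuous fun p : U11 × H31 => (p.1.1.1.det)⁻¹ :=
      hm.matrix_det.inv₀ fun p h0 => by simpa [h0] using U11_det p.1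
    have h1 := he 0 0
    have h2 := he 0 1
    fun_prop
  isometry u := by
    refine ⟨isSmooth_smul_U11 u, isSmooth_smul_U11 u⁻¹, ?_⟩
    intro z x hx y hy
    change metric lam mu mu (u • z) (dirD (fun y => (u • y : H31).1) z x)
      (dirD (fun y => (u • y : H31).1) z y) = _
    rw [dirD_smul_U11 u hx, dirD_smul_U11 u hy]
    obtain ⟨a0, a1, a2⟩ := theta_actionCLM u z x
    obtain ⟨b0, b1, b2⟩ := theta_actionCLM u z y
    simp only [metric, a0, a1, a2, b0, b1, b2]
    linear_combination mu * (theta 1 z x * theta 1 z y + theta 2 z x * theta 2 z y)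
      * det_inv_re_im u

/-- An action that factors through a continuous homomorphism to `U(1,1)` is isometric. -/
theorem actsByIsometries_of_hom (lam mu : ℝ) {G : Type*} [Group G] [TopologicalSpace G]
    [MulAction G H31] (f : G →* U11) (hf : Continuous f) (h : ∀ g (z : H31), f g • z = g • z) :
    ActsByIsometries lam mu mu G where
  continuous := by
    have := (actsByIsometries_U11 lam mu).continuous
    constructor
    simp only [← h]
    exact continuous_smul.comp (hf.prodMap continuous_id)
  isometry g := by
    have : (MulAction.toPerm g : H31 ≃ H31) = MulAction.toPerm (f g) := by
      ext1 z
      exact (h g z).symm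
    rw [this]
    exact (actsByIsometries_U11 lam mu).isometry (f g)

theorem continuous_inclU : Continuous inclU :=
  Continuous.subtype_mk continuous_subtype_val _

theorem continuous_psi : Continuous psi := by
  apply Continuous.subtype_mk (f := fun p => (psi p).1)
  rw [Units.continuous_iff]
  have h1 : Continuous fun p : SU11 × Circle => p.1.1 := continuous_subtype_val.comp continuous_fst
  have h2 : Continuous fun p : SU11 × Circle => (p.2 : ℂ) :=
    continuous_subtype_val.comp continuous_snd
  constructor
  · exact (h2.inv₀ fun p => p.2.coe_ne_zero).smul (Units.continuous_val.comp h1)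
  · exact h2.smul (Units.continuous_val.comp h1.inv)

theorem isPretransitive_SU11 : MulAction.IsPretransitive SU11 H31 := by
  refine ⟨fun z w => ⟨toSU w * (toSU z)⁻¹, ?_⟩⟩
  change toSU.symm (toSU w * (toSU z)⁻¹ * toSU z) = w
  simp

theorem isPretransitive_U11 : MulAction.IsPretransitive U11 H31 := by
  refine ⟨fun z w => ?_⟩
  obtain ⟨A, hA⟩ := isPretransitive_SU11.exists_smul_eq z w
  exact ⟨inclU A, by rw [inclU_smul, hA]⟩

theorem isPretransitive_prod : MulAction.IsPretransitive (SU11 × Circle) H31 := by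
  refine ⟨fun z w => ?_⟩
  obtain ⟨u, hu⟩ := isPretransitive_U11.exists_smul_eq z w
  obtain ⟨p, rfl⟩ := psi_surjective u
  exact ⟨p, by rw [← psi_smul, hu]⟩

/-- The stabilizer of the base point in `U(1,1)` consists of the matrices `diag(1, d)`. -/
theorem mem_stabilizer_U11 (u : U11) :
    u ∈ MulAction.stabilizer U11 o ↔ u.1.1 = !![1, 0; 0, u.1.1.det] := by
  have hd : u.1.1.det ≠ 0 := fun h0 => by simpa [h0] using U11_det u
  rw [MulAction.mem_stabilizer_iff]
  have ho : toMat o.1 = 1 := by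
    ext i j
    fin_cases i <;> fin_cases j <;> simp [toMat, o]
  have key : (u • o = o) ↔ u.1.1 * !![1, 0; 0, (u.1.1.det)⁻¹] = 1 := by
    rw [← ho, ← toMat_injective.eq_iff.trans Subtype.ext_iff.symm, toMat_smul_U11, ho, mul_one]
  have h2 : (!![1, 0; 0, u.1.1.det] : Mat) * !![1, 0; 0, (u.1.1.det)⁻¹] = 1 := by
    ext i j
    fin_cases i <;> fin_cases j <;> simp [Matrix.mul_apply, Fin.sum_univ_two, hd]
  rw [key]
  constructor
  · intro h
    exact left_inv_eq_right_inv h (mul_eq_one_comm.mp h2)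
  · intro h
    nth_rewrite 1 [h]
    exact h2

theorem U11_eq_one_of_smul {u : U11} (hu : ∀ z : H31, u • z = z) : u = 1 := by
  have h1 := (mem_stabilizer_U11 u).mp (hu o)
  -- The point `(√2, 1)` detects the remaining rotation `diag(1, det u)`.
  have h2 := congrArg (fun z : H31 => z.1.2) (hu ⟨((Real.sqrt 2 : ℝ), 1), by
    simp [quad]; norm_num⟩)
  simp only [smul_U11_val, actionCLM_apply] at h2
  have e0 : u.1.1 0 0 = 1 := by rw [h1]; rfl
  have e1 : u.1.1 0 1 = 0 := by rw [h1]; rfl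
  rw [e0, e1] at h2
  simp at h2
  apply Subtype.ext
  apply Units.ext
  rw [h1, h2]
  ext i j
  fin_cases i <;> fin_cases j <;> simp

theorem faithfulSMul_U11 : FaithfulSMul U11 H31 := by
  refine ⟨fun {u v} h => ?_⟩
  have : v⁻¹ * u = 1 := U11_eq_one_of_smul fun z => by rw [mul_smul, h, inv_smul_smul]
  exact (inv_mul_eq_one.mp this).symm

theorem faithfulSMul_SU11 : FaithfulSMul SU11 H31 := by
  refine ⟨fun {A B} h => inclU_injective ?_⟩
  exact faithfulSMul_U11.eq_of_smul_eq_smul fun z => by rw [inclU_smul, inclU_smul, h]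

/-- The kernel of the action consists of the pairs `(w, w)` with `w = ±1`. -/
theorem almostEffective_prod : AlmostEffective (SU11 × Circle) := by
  have hpsi : ∀ p ∈ (MulAction.toPermHom (SU11 × Circle) H31).ker,
      p.1.1.1 = (p.2 : ℂ) • (1 : Mat) := by
    intro p hp
    have h1 : psi p = 1 := U11_eq_one_of_smul fun z => by
      rw [psi_smul]
      exact congrArg (fun e : Equiv.Perm H31 => e z) hp
    have h2 : (p.2 : ℂ)⁻¹ • p.1.1.1 = 1 := by rw [← psi_val, h1]; rfl
    rw [← h2, smul_smul, mul_inv_cancel₀ p.2.coe_ne_zero, one_smul]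
  have hfin : Finite (MulAction.toPermHom (SU11 × Circle) H31).ker := by
    have : Finite ({1, -1} : Set ℂ) := Set.toFinite _
    refine Finite.of_injective (β := ({1, -1} : Set ℂ)) (fun p => ⟨(p.1.2 : ℂ), ?_⟩) ?_
    · have h := SU11_det p.1.1
      rw [hpsi p.1 p.2, Matrix.det_smul] at h
      simp only [Fintype.card_fin, Matrix.det_one, mul_one] at h
      exact sq_eq_one_iff.mp h
    · intro p q h
      have h1 : (p.1.2 : ℂ) = q.1.2 := congrArg (fun c : ({1, -1} : Set ℂ) => (c : ℂ)) h
      apply Subtype.ext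
      refine Prod.ext ?_ (Circle.ext h1)
      apply Subtype.ext
      apply Units.ext
      rw [hpsi p.1 p.2, hpsi q.1 q.2, h1]
  unfold AlmostEffective
  infer_instance

/-! ### Invariance of the connection -/

/-- The connection `∇ - S_λ(t)` is invariant under `U(1,1)`. -/
theorem isPushforward_cov_U11 (lam mu t : ℝ) (hlam : lam ≠ 0) (hmu : mu ≠ 0) (k : U11)
    {X X' Y Y' : VF} (hX : IsPushforward k X X') (hY : IsPushforward k Y Y') :
    IsPushforward k (((leviCivita lam mu).subTensor (S12 lam mu mu t)).cov X Y)
      (((leviCivita lam mu).subTensor (S12 lam mu mu t)).cov X' Y') := by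
  have push : ∀ {V V' : VF}, IsPushforward k V V' → ∀ z, V'.1 (k • z) = actionCLM k (V.1 z) :=
    fun {V V'} h z => by rw [h z, dirD_smul_U11 k (V.2.2 z)]
  set a := (k.1.1.det)⁻¹.re
  set b := (k.1.1.det)⁻¹.im
  have cX : ∀ {V V' : VF}, IsPushforward k V V' → ∀ z,
      (coord 0 V').1 (k • z) = (coord 0 V).1 z ∧
      (coord 1 V').1 (k • z) = a * (coord 1 V).1 z - b * (coord 2 V).1 z ∧
      (coord 2 V').1 (k • z) = a * (coord 2 V).1 z + b * (coord 1 V).1 z := by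
    intro V V' h z
    have := theta_actionCLM k z (V.1 z)
    rw [← push h z] at this
    exact this
  -- Differentiating a component of `Y'` along `X'` is differentiating its pullback along `X`.
  have cD : ∀ (f : SmoothFn) z, (derivAlong X' f).1 (k • z)
      = dirD (fun y => f.1 (k • y)) z (X.1 z) := by
    intro f z
    rw [dirD_comp f.2 (isSmooth_smul_U11 k) z, ← hX z]
    rfl
  have d0 : ∀ z, (derivAlong X' (coord 0 Y')).1 (k • z) = (derivAlong X (coord 0 Y)).1 z := by
    intro z
    rw [cD, derivAlong_apply]
    congr 1
    funext y
    exact (cX hY y).1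
  have d1 : ∀ z, (derivAlong X' (coord 1 Y')).1 (k • z)
      = a * (derivAlong X (coord 1 Y)).1 z - b * (derivAlong X (coord 2 Y)).1 z := by
    intro z
    have : (fun y => (coord 1 Y').1 (k • y)) = (a • coord 1 Y - b • coord 2 Y : SmoothFn).1 := by
      funext y
      exact (cX hY y).2.1
    rw [cD, this, ← derivAlong_apply, derivAlong_sub, derivAlong_smul, derivAlong_smul]
    rfl
  have d2 : ∀ z, (derivAlong X' (coord 2 Y')).1 (k • z)
      = a * (derivAlong X (coord 2 Y)).1 z + b * (derivAlong X (coord 1 Y)).1 z := by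
    intro z
    have : (fun y => (coord 2 Y').1 (k • y)) = (a • coord 2 Y + b • coord 1 Y : SmoothFn).1 := by
      funext y
      exact (cX hY y).2.2
    rw [cD, this, ← derivAlong_apply, derivAlong_add, derivAlong_smul, derivAlong_smul]
    rfl
  set D := (leviCivita lam mu).subTensor (S12 lam mu mu t)
  set κ := (lam + 2 * mu - t) / mu
  have cov : ∀ (V W : VF) z,
      (coord 0 (D.cov V W)).1 z = (derivAlong V (coord 0 W)).1 z ∧
      (coord 1 (D.cov V W)).1 z = (derivAlong V (coord 1 W)).1 z
        - κ * ((coord 0 V).1 z * (coord 2 W).1 z) ∧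
      (coord 2 (D.cov V W)).1 z = (derivAlong V (coord 2 W)).1 z
        + κ * ((coord 0 V).1 z * (coord 1 W).1 z) := by
    intro V W z
    obtain ⟨h0, h1, h2⟩ := coord_sub_S12 lam mu t hlam hmu V W
    exact ⟨by rw [h0], by rw [h1]; rfl, by rw [h2]; rfl⟩
  intro z
  rw [dirD_smul_U11 k ((D.cov X Y).2.2 z)]
  have htan : actionCLM k ((D.cov X Y).1 z) ∈ tangent (k • z) := by
    change bil (k • z : H31).1 _ = 0
    rw [smul_U11_val, bil_actionCLM]
    exact (D.cov X Y).2.2 z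
  rw [← sum_theta_frame (k • z) _ ((D.cov X' Y').2.2 (k • z)),
    ← sum_theta_frame (k • z) _ htan]
  obtain ⟨e0, e1, e2⟩ := cov X Y z
  obtain ⟨f0, f1, f2⟩ := cov X' Y' (k • z)
  obtain ⟨x0, x1, x2⟩ := cX hX z
  obtain ⟨y0, y1, y2⟩ := cX hY z
  obtain ⟨t0, t1, t2⟩ := theta_actionCLM k z ((D.cov X Y).1 z)
  rw [d0] at f0
  rw [d1, x0, y2] at f1
  rw [d2, x0, y1] at f2
  refine Finset.sum_congr rfl fun i _ => ?_
  congr 1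
  fin_cases i
  · exact (f0.trans e0.symm).trans t0.symm
  · refine f1.trans (Eq.trans ?_ t1.symm)
    change _ = a * (coord 1 (D.cov X Y)).1 z - b * (coord 2 (D.cov X Y)).1 z
    rw [e1, e2]
    ring
  · refine f2.trans (Eq.trans ?_ t2.symm)
    change _ = a * (coord 2 (D.cov X Y)).1 z + b * (coord 1 (D.cov X Y)).1 z
    rw [e1, e2]
    ring

/-! ### One-parameter groups of matrices -/

theorem expGL_val (B : Mat) : (expGL B).1 = NormedSpace.exp B := rfl

theorem expGL_zero_val (B : Mat) : (expGL ((0 : ℝ) • B)).1 = 1 := by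
  rw [zero_smul, expGL_val, NormedSpace.exp_zero]

theorem hasDerivAt_expGL_apply (B : Mat) (i j : Fin 2) (s : ℝ) :
    HasDerivAt (fun s : ℝ => (expGL (s • B)).1 i j) (((expGL (s • B)).1 * B) i j) s := by
  let : NormedRing Mat := Matrix.linftyOpNormedRing
  let : NormedAlgebra ℝ Mat := Matrix.linftyOpNormedAlgebra
  have h : HasDerivAt (fun s : ℝ => NormedSpace.exp (s • B)) (NormedSpace.exp (s • B) * B) s :=
    hasDerivAt_exp_smul_const B s
  let L : Mat →L[ℝ] ℂ := LinearMap.toContinuousLinearMap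
    { toFun := fun M => M i j
      map_add' := fun _ _ => rfl
      map_smul' := fun _ _ => rfl }
  exact L.hasFDerivAt.comp_hasDerivAt s h

theorem hasDerivAt_expGL_apply_zero (B : Mat) (i j : Fin 2) :
    HasDerivAt (fun s : ℝ => (expGL (s • B)).1 i j) (B i j) 0 := by
  have h := hasDerivAt_expGL_apply B i j 0
  rwa [expGL_zero_val, one_mul] at h

theorem hasDerivAt_det_expGL (B : Mat) (s : ℝ) :
    HasDerivAt (fun s : ℝ => (expGL (s • B)).1.det) ((expGL (s • B)).1.det * B.trace) s := by
  have e := fun i j => hasDerivAt_expGL_apply B i j s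
  have h := ((e 0 0).mul (e 1 1)).sub ((e 0 1).mul (e 1 0))
  simp only [Matrix.det_fin_two, Matrix.trace_fin_two]
  refine h.congr_deriv ?_
  simp only [Matrix.mul_apply, Fin.sum_univ_two]
  ring

theorem hasDerivAt_det_expGL_zero (B : Mat) :
    HasDerivAt (fun s : ℝ => (expGL (s • B)).1.det) B.trace 0 := by
  have h := hasDerivAt_det_expGL B 0
  rwa [expGL_zero_val, Matrix.det_one, one_mul] at h

theorem det_expGL_of_trace_eq_zero {B : Mat} (hB : B.trace = 0) (s : ℝ) :
    (expGL (s • B)).1.det = 1 := by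
  have h := is_const_of_deriv_eq_zero (𝕜 := ℝ) (f := fun s : ℝ => (expGL (s • B)).1.det)
    (fun s => (hasDerivAt_det_expGL B s).differentiableAt)
    (fun s => by rw [(hasDerivAt_det_expGL B s).deriv, hB, mul_zero]) s 0
  rw [h, expGL_zero_val, Matrix.det_one]

theorem eq_zero_of_expGL_apply_const {B : Mat} {i j : Fin 2} {c : ℂ}
    (h : ∀ s : ℝ, (expGL (s • B)).1 i j = c) : B i j = 0 := by
  have h1 := hasDerivAt_expGL_apply_zero B i j
  simp only [h] at h1
  exact h1.unique (hasDerivAt_const _ _)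

/-! ### The Lie algebras of the groups and of their isotropy groups -/

theorem mem_u11_iff (B : Mat) :
    B ∈ u11 ↔ (B 0 0).re = 0 ∧ (B 1 1).re = 0 ∧ B 1 0 = star (B 0 1) := by
  have h : B ∈ u11 ↔ Bᴴ * J + J * B = 0 := Iff.rfl
  rw [h, ← Matrix.ext_iff]
  simp only [Fin.forall_fin_two, Matrix.add_apply, Matrix.mul_apply, Fin.sum_univ_two,
    Matrix.conjTranspose_apply]
  simp [J, Complex.ext_iff]
  constructor
  · rintro ⟨⟨h1, h2, h3⟩, -, h4⟩
    exact ⟨h1, h4, by linarith, by linarith⟩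
  · rintro ⟨h1, h2, h3, h4⟩
    exact ⟨⟨h1, by linarith, by linarith⟩, ⟨by linarith, by linarith⟩, h2⟩

theorem expGL_mem_U11 {B : Mat} (hB : B ∈ u11) : expGL B ∈ U11 := by
  have hB' : Bᴴ * J + J * B = 0 := hB
  have hJ : J * J = 1 := by
    ext i j
    fin_cases i <;> fin_cases j <;> simp [J, Matrix.mul_apply, Fin.sum_univ_two]
  have h1 : Bᴴ = J * (-B) * J := by
    have := eq_neg_of_add_eq_zero_left hB'
    calc Bᴴ = Bᴴ * J * J := by rw [Matrix.mul_assoc, hJ, mul_one]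
      _ = _ := by rw [this]; noncomm_ring
  have h2 := Matrix.exp_units_conj (⟨J, J, hJ, hJ⟩ : Matˣ) (-B)
  have h3 : NormedSpace.exp (-B) * NormedSpace.exp B = 1 := by
    rw [← Matrix.exp_add_of_commute _ _ (Commute.neg_left (Commute.refl B)), neg_add_cancel,
      NormedSpace.exp_zero]
  change (NormedSpace.exp B)ᴴ * J * NormedSpace.exp B = J
  rw [← Matrix.exp_conjTranspose, h1]
  refine (congrArg (fun M : Mat => M * J * NormedSpace.exp B) h2).trans ?_
  change J * NormedSpace.exp (-B) * J * J * NormedSpace.exp B = J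
  rw [Matrix.mul_assoc _ J J, hJ, mul_one, Matrix.mul_assoc, h3, mul_one]

theorem isLieAlgebraOf_u11 : IsLieAlgebraOf u11.toSubmodule U11 := by
  intro B
  constructor
  · intro hB s
    exact expGL_mem_U11 (u11.smul_mem s hB)
  · intro h
    have e := fun i j => hasDerivAt_expGL_apply_zero B i j
    have e0 : ∀ i j, (expGL ((0 : ℝ) • B)).1 i j = (1 : Mat) i j := fun i j => by
      rw [expGL_zero_val]
    -- Differentiate the four entries of `exp(sB)ᴴ J exp(sB) = J` at `s = 0`.
    have key : ∀ i j, (star (B 0 i) * (1 : Mat) 0 j + star ((1 : Mat) 0 i) * B 0 j)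
        - (star (B 1 i) * (1 : Mat) 1 j + star ((1 : Mat) 1 i) * B 1 j) = 0 := by
      intro i j
      have d := ((e 0 i).star.mul (e 0 j)).sub ((e 1 i).star.mul (e 1 j))
      simp only [e0] at d
      have hc : ((fun s : ℝ => star ((expGL (s • B)).1 0 i)) * (fun s : ℝ => (expGL (s • B)).1 0 j))
          - ((fun s : ℝ => star ((expGL (s • B)).1 1 i)) * fun s : ℝ => (expGL (s • B)).1 1 j)
          = fun _ : ℝ => J i j := by
        funext s
        have hs : (expGL (s • B)).1ᴴ * J * (expGL (s • B)).1 = J := h s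
        have := congrFun (congrFun hs i) j
        simp only [Matrix.mul_apply, Fin.sum_univ_two, Matrix.conjTranspose_apply] at this
        rw [← this]
        simp [J]
        ring
      rw [hc] at d
      exact d.unique (hasDerivAt_const _ _)
    change B ∈ u11
    rw [mem_u11_iff]
    have k00 := congrArg Complex.re (key 0 0)
    have k11 := congrArg Complex.re (key 1 1)
    have k10 := key 1 0
    simp at k00 k11 k10
    refine ⟨by linarith, by linarith, ?_⟩
    simp only [RCLike.star_def]
    linear_combination -k10

theorem expGL_mem_SU11 {B : Mat} (hB : B ∈ su11) (s : ℝ) : expGL (s • B) ∈ SU11 := by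
  refine ⟨expGL_mem_U11 (u11.smul_mem s hB.1), ?_⟩
  apply Units.ext
  exact det_expGL_of_trace_eq_zero hB.2 s

theorem isLieAlgebraOf_su11 : IsLieAlgebraOf su11.toSubmodule SU11 := by
  intro B
  constructor
  · exact fun hB s => expGL_mem_SU11 hB s
  · intro h
    refine ⟨(isLieAlgebraOf_u11 B).mpr fun s => (h s).1, ?_⟩
    have hd := hasDerivAt_det_expGL_zero B
    have h1 : (fun s : ℝ => (expGL (s • B)).1.det) = fun _ => 1 := by
      funext s
      exact SU11_det ⟨_, h s⟩
    rw [h1] at hd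
    exact hd.unique (hasDerivAt_const _ _)

theorem mem_hSpan_iff (B : Mat) :
    B ∈ hSpan ↔ B 0 0 = 0 ∧ B 0 1 = 0 ∧ B 1 0 = 0 ∧ (B 1 1).re = 0 := by
  unfold hSpan
  rw [Submodule.mem_span_singleton]
  constructor
  · rintro ⟨c, rfl⟩
    simp
  · rintro ⟨h0, h1, h2, h3⟩
    refine ⟨(B 1 1).im, ?_⟩
    ext i j
    fin_cases i <;> fin_cases j <;> simp [h0, h1, h2]
    apply Complex.ext <;> simp [h3]

theorem hSpan_le_u11 : hSpan ≤ u11.toSubmodule := by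
  intro B hB
  obtain ⟨h0, h1, h2, h3⟩ := (mem_hSpan_iff B).mp hB
  exact (mem_u11_iff B).mpr ⟨by rw [h0]; rfl, h3, by rw [h1, h2, star_zero]⟩

theorem isLieAlgebraOf_hSpan :
    IsLieAlgebraOf hSpan ((MulAction.stabilizer U11 o).map U11.subtype) := by
  intro B
  constructor
  · intro hB s
    have hs := hSpan.smul_mem s hB
    refine ⟨⟨expGL (s • B), expGL_mem_U11 (hSpan_le_u11 hs)⟩, ?_, rfl⟩
    change _ ∈ MulAction.stabilizer U11 o
    rw [mem_stabilizer_U11]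
    obtain ⟨h0, h1, h2, -⟩ := (mem_hSpan_iff _).mp hs
    have hd : s • B = Matrix.diagonal ![0, (s • B) 1 1] := by
      ext i j
      fin_cases i <;> fin_cases j <;> simp [h0, h1, h2]
    change (expGL (s • B)).1 = !![1, 0; 0, (expGL (s • B)).1.det]
    rw [expGL_val, hd, Matrix.exp_diagonal]
    ext i j
    fin_cases i <;> fin_cases j <;> simp [Pi.coe_exp]
  · intro h
    have hu : B ∈ u11 := (isLieAlgebraOf_u11 B).mpr fun s => by
      obtain ⟨u, -, hu⟩ := h s
      rw [← hu]
      exact u.2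
    have hst : ∀ s : ℝ, (expGL (s • B)).1 = !![1, 0; 0, (expGL (s • B)).1.det] := by
      intro s
      obtain ⟨u, hu1, hu2⟩ := h s
      have := (mem_stabilizer_U11 u).mp hu1
      rw [← hu2]
      exact this
    rw [mem_hSpan_iff]
    refine ⟨eq_zero_of_expGL_apply_const (c := 1) fun s => ?_,
      eq_zero_of_expGL_apply_const (c := 0) fun s => ?_,
      eq_zero_of_expGL_apply_const (c := 0) fun s => ?_, ((mem_u11_iff B).mp hu).2.1⟩ <;>
    · rw [hst s]; rfl

theorem stabilizer_SU11_eq_bot : MulAction.stabilizer SU11 o = ⊥ := by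
  rw [eq_bot_iff]
  intro A hA
  have h1 : inclU A ∈ MulAction.stabilizer U11 o := by
    rw [MulAction.mem_stabilizer_iff, inclU_smul]
    exact hA
  rw [mem_stabilizer_U11, inclU_val, SU11_det] at h1
  rw [Subgroup.mem_bot]
  apply Subtype.ext
  apply Units.ext
  rw [h1]
  ext i j
  fin_cases i <;> fin_cases j <;> simp

theorem isLieAlgebraOf_bot :
    IsLieAlgebraOf ⊥ ((MulAction.stabilizer SU11 o).map SU11.subtype) := by
  intro B
  rw [stabilizer_SU11_eq_bot, Subgroup.map_bot]
  constructor
  · intro hB s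
    rw [(Submodule.mem_bot ℝ).mp hB, Subgroup.mem_bot]
    apply Units.ext
    rw [smul_zero, expGL_val, NormedSpace.exp_zero]
    rfl
  · intro h
    rw [Submodule.mem_bot]
    ext i j
    refine eq_zero_of_expGL_apply_const (c := (1 : Mat) i j) fun s => ?_
    rw [Subgroup.mem_bot.mp (h s)]
    rfl

/-- The second condition expresses that `tr B` is `κ` times the entry `B₀₀`, where
`κ = (λ + 2μ - t)/μ`. -/
theorem mem_mSpan_iff (lam mu t : ℝ) (hmu : mu ≠ 0) (B : Mat) :
    B ∈ mSpan lam mu t ↔ B ∈ u11 ∧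
      (B 1 1).im = ((lam + 2 * mu - t) / mu - 1) * (B 0 0).im := by
  have e : (lam + 2 * mu - t) / mu - 1 = 1 + (lam - t) / mu := by
    field_simp
    ring
  rw [e, mem_u11_iff]
  unfold mSpan
  rw [Submodule.mem_span_triple]
  constructor
  · rintro ⟨a, b, c, rfl⟩
    simp
    ring
  · rintro ⟨⟨h1, h2, h3⟩, h4⟩
    refine ⟨(B 0 0).im, (B 0 1).re, (B 0 1).im, ?_⟩
    ext i j
    fin_cases i <;> fin_cases j <;> simp [h3, Complex.ext_iff, h1, h2, h4]
    ring

theorem isReductiveDecomposition_U11 (lam mu t : ℝ) (hmu : mu ≠ 0) :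
    IsReductiveDecomposition U11 u11 (mSpan lam mu t) hSpan where
  lie_group := isLieAlgebraOf_u11
  lie_isotropy := isLieAlgebraOf_hSpan
  disjoint := by
    rw [eq_bot_iff]
    rintro B ⟨hm, hh⟩
    obtain ⟨-, h4⟩ := (mem_mSpan_iff lam mu t hmu B).mp hm
    obtain ⟨h0, h1, h2, h3⟩ := (mem_hSpan_iff B).mp hh
    rw [h0, Complex.zero_im, mul_zero] at h4
    rw [Submodule.mem_bot]
    ext i j
    fin_cases i <;> fin_cases j <;> simp [h0, h1, h2]
    exact Complex.ext h3 h4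
  span := by
    apply le_antisymm
    · exact sup_le (fun B hB => ((mem_mSpan_iff lam mu t hmu B).mp hB).1) hSpan_le_u11
    · intro B hB
      have hB' := (mem_u11_iff B).mp hB
      set c : ℝ := ((lam + 2 * mu - t) / mu - 1) * (B 0 0).im
      rw [Submodule.mem_sup]
      refine ⟨!![B 0 0, B 0 1; B 1 0, c * Complex.I], ?_,
        !![0, 0; 0, B 1 1 - c * Complex.I], ?_, ?_⟩
      · rw [mem_mSpan_iff lam mu t hmu, mem_u11_iff]
        refine ⟨⟨by simpa using hB'.1, by simp, by simpa using hB'.2.2⟩, by simp [c]⟩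
      · rw [mem_hSpan_iff]
        simpa using hB'.2.1
      · ext i j
        fin_cases i <;> fin_cases j <;> simp
  ad_invariant := by
    intro k hk B hB
    rw [mem_stabilizer_U11] at hk
    have hdd := U11_det k
    have hd : k.1.1.det ≠ 0 := fun h0 => by simp [h0] at hdd
    have hinv : (k.1⁻¹).1 = !![1, 0; 0, (k.1.1.det)⁻¹] := by
      refine left_inv_eq_right_inv k.1.inv_mul ?_
      rw [hk]
      ext i j
      fin_cases i <;> fin_cases j <;> simp [Matrix.mul_apply, Fin.sum_univ_two, hd]
    have hprod : k.1.1 * B * (k.1⁻¹).1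
        = !![B 0 0, B 0 1 * (k.1.1.det)⁻¹; k.1.1.det * B 1 0, B 1 1] := by
      rw [hinv]
      nth_rewrite 1 [hk]
      ext i j
      fin_cases i <;> fin_cases j <;>
        simp [Matrix.mul_apply, Matrix.vecMul, dotProduct, Fin.sum_univ_two]
      field_simp
    rw [mem_mSpan_iff lam mu t hmu, mem_u11_iff] at hB ⊢
    rw [hprod]
    obtain ⟨⟨h1, h2, h3⟩, h4⟩ := hB
    refine ⟨⟨by simpa using h1, by simpa using h2, ?_⟩, by simpa using h4⟩
    have : star (k.1.1.det)⁻¹ = k.1.1.det := by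
      rw [star_inv₀]
      exact inv_eq_of_mul_eq_one_left hdd
    change k.1.1.det * B 1 0 = star (B 0 1 * (k.1.1.det)⁻¹)
    rw [star_mul', this, h3, mul_comm]

theorem isReductiveDecomposition_SU11 :
    IsReductiveDecomposition SU11 su11 su11.toSubmodule ⊥ where
  lie_group := isLieAlgebraOf_su11
  lie_isotropy := isLieAlgebraOf_bot
  disjoint := inf_bot_eq _
  span := sup_bot_eq _
  ad_invariant := by
    intro k hk B hB
    rw [stabilizer_SU11_eq_bot, Subgroup.mem_bot] at hk
    rw [hk]
    simpa using hB

/-! ### Fundamental vector fields -/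

/-- The derivative at the identity of the action of `U(1,1)` on `ℂ²`, in the direction `B`. -/
def fundamentalField (B : Mat) (z : ℂ × ℂ) : ℂ × ℂ :=
  (B 0 0 * z.1 + B 0 1 * star z.2, B 0 0 * z.2 + B 0 1 * star z.1 - B.trace * z.2)

theorem fundamental_U11 {B : Mat} (hB : B ∈ u11) (z : H31) :
    fundamental U11 B z = fundamentalField B z.1 := by
  have hm : ∀ s : ℝ, expGL (s • B) ∈ U11 := (isLieAlgebraOf_u11 B).mp hB
  unfold fundamental
  simp only [hm, dif_pos, smul_U11_val, actionCLM_apply]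
  have e := fun i j => hasDerivAt_expGL_apply_zero B i j
  have hd0 : (expGL ((0 : ℝ) • B)).1.det = 1 := by rw [expGL_zero_val, Matrix.det_one]
  have hd := (hasDerivAt_det_expGL_zero B).inv (by rw [hd0]; exact one_ne_zero)
  have h1 := ((e 0 0).mul_const z.1.1).add ((e 0 1).mul_const (star z.1.2))
  have h2 := hd.mul (((e 0 0).mul_const z.1.2).add ((e 0 1).mul_const (star z.1.1)))
  have h3 := (h1.prodMk h2).deriv
  refine h3.trans ?_
  simp only [fundamentalField, Pi.inv_apply, Pi.add_apply, expGL_zero_val]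
  simp
  ring

theorem fundamental_SU11 {B : Mat} (hB : B ∈ su11) (z : H31) :
    fundamental SU11 B z = fundamentalField B z.1 := by
  rw [← fundamental_U11 hB.1]
  unfold fundamental
  congr 1
  funext s
  have h1 := expGL_mem_SU11 hB s
  have h2 : expGL (s • B) ∈ U11 := h1.1
  rw [dif_pos h1, dif_pos h2, ← inclU_smul]
  rfl

theorem fundamentalField_o (B : Mat) : fundamentalField B o.1 = (B 0 0, B 0 1) := by
  simp [fundamentalField, o]

/-! ### The canonical connection -/

theorem theta_o (v : ℂ × ℂ) :
    theta 0 o v = v.1.im ∧ theta 1 o v = v.2.re ∧ theta 2 o v = v.2.im := by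
  simp [theta, o]

theorem mem_tangent_o (v : ℂ × ℂ) : v ∈ tangent o ↔ v.1.re = 0 := by
  change bil o.1 v = 0 ↔ _
  simp [bil, o]

/-- The derivative at `o` of a function that is a quadratic polynomial on the line `o + s v`. -/
theorem dirD_o_of_expansion {f : ℂ × ℂ → ℝ} (hf : ContDiff ℝ ∞ f) {v : ℂ × ℂ}
    (hv : v ∈ tangent o) {a b c : ℝ} (h : ∀ s : ℝ, f (o.1 + s • v) = a + s * b + s ^ 2 * c) :
    dirD (fun y : H31 => f y.1) o v = b := by
  have hd : DifferentiableAt ℝ f o.1 := hf.differentiable (by simp) _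
  rw [dirD_comp_coe hd hv]
  have hc : HasDerivAt (fun s : ℝ => o.1 + s • v) v 0 := by
    simpa using ((hasDerivAt_id (0 : ℝ)).smul_const v).const_add o.1
  have h1 : HasFDerivAt f (fderiv ℝ f o.1) (o.1 + (0 : ℝ) • v) := by
    simpa using hd.hasFDerivAt
  have h2 := HasFDerivAt.comp_hasDerivAt (0 : ℝ) h1 hc
  have h3 : HasDerivAt (fun s : ℝ => a + s * b + s ^ 2 * c) b 0 := by
    have := ((((hasDerivAt_id (0 : ℝ)).mul_const b).const_add a).add
      (((hasDerivAt_id (0 : ℝ)).pow 2).mul_const c))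
    simpa [Pi.add_def] using this
  refine HasDerivAt.unique h2 (h3.congr_of_eventuallyEq ?_)
  exact Filter.Eventually.of_forall fun s => h s

theorem contDiff_star : ContDiff ℝ ∞ (fun z : ℂ => star z) := Complex.conjCLE.contDiff

theorem contDiff_fundamentalField (B : Mat) : ContDiff ℝ ∞ (fundamentalField B) := by
  have := contDiff_star
  unfold fundamentalField
  fun_prop

/-- The value at `o` of `D_{B*} C*`, for `D = ∇ - S_λ(t)`: it is minus the first row of `[B,C]`
when `tr B = κ B₀₀` with `κ = (λ + 2μ - t)/μ`. The rotation term `κ θ⁰(B*)` of `D` then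
compensates the part of `[B,C]` that comes from the trace of `B`. -/
theorem cov_fundamentalField_o (lam mu t : ℝ) (hlam : lam ≠ 0) (hmu : mu ≠ 0) {B C : Mat}
    (hB : B ∈ u11) (hC : C ∈ u11)
    (htr : (B 1 1).im = ((lam + 2 * mu - t) / mu - 1) * (B 0 0).im) {X Y : VF}
    (hX : ∀ z, X.1 z = fundamentalField B z.1) (hY : ∀ z, Y.1 z = fundamentalField C z.1) :
    (((leviCivita lam mu).subTensor (S12 lam mu mu t)).cov X Y).1 o
      = -((B * C - C * B) 0 0, (B * C - C * B) 0 1) := by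
  obtain ⟨hB0, hB1, hB2⟩ := (mem_u11_iff B).mp hB
  obtain ⟨hC0, hC1, hC2⟩ := (mem_u11_iff C).mp hC
  have hXo : X.1 o = (B 0 0, B 0 1) := by rw [hX, fundamentalField_o]
  have hYo : Y.1 o = (C 0 0, C 0 1) := by rw [hY, fundamentalField_o]
  have hs := contDiff_star
  have hF := contDiff_fundamentalField C
  have p0 : ContDiff ℝ ∞ fun w : ℂ × ℂ =>
      star w.1 * (fundamentalField C w).1 - w.2 * star (fundamentalField C w).2 := by
    fun_prop
  have p1 : ContDiff ℝ ∞ fun w : ℂ × ℂ =>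
      star w.1 * (fundamentalField C w).2 - w.2 * star (fundamentalField C w).1 := by
    fun_prop
  have d0 : (derivAlong X (coord 0 Y)).1 o = 2 * (star (B 0 1) * C 0 1).im := by
    have hf : ContDiff ℝ ∞ fun w : ℂ × ℂ =>
        (star w.1 * (fundamentalField C w).1 - w.2 * star (fundamentalField C w).2).im :=
      Complex.imCLM.contDiff.comp p0
    have e : (coord 0 Y).1 = fun y : H31 =>
        (star y.1.1 * (fundamentalField C y.1).1 - y.1.2 * star (fundamentalField C y.1).2).im := by
      funext y
      rw [← hY]
      rfl
    rw [derivAlong_apply, e]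
    refine dirD_o_of_expansion hf (X.2.2 o) (a := (C 0 0).im)
      (c := (star (B 0 0) * C 0 0 * B 0 0 + star (B 0 0) * C 0 1 * star (B 0 1)
        - B 0 1 * star (C 0 0 * B 0 1 + C 0 1 * star (B 0 0) - C.trace * B 0 1)).im) ?_
    intro s
    rw [hXo]
    simp [fundamentalField, o, Matrix.trace_fin_two, hB0, hC0, hC1]
    ring
  have d1 : (derivAlong X (coord 1 Y)).1 o
      = 2 * (B 0 0).im * (C 0 1).im - ((C 0 0).im - (C 1 1).im) * (B 0 1).im := by
    have hf : ContDiff ℝ ∞ fun w : ℂ × ℂ =>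
        (star w.1 * (fundamentalField C w).2 - w.2 * star (fundamentalField C w).1).re :=
      Complex.reCLM.contDiff.comp p1
    have e : (coord 1 Y).1 = fun y : H31 =>
        (star y.1.1 * (fundamentalField C y.1).2 - y.1.2 * star (fundamentalField C y.1).1).re := by
      funext y
      rw [← hY]
      rfl
    rw [derivAlong_apply, e]
    refine dirD_o_of_expansion hf (X.2.2 o) (a := (C 0 1).re)
      (c := (star (B 0 0) * (C 0 0 * B 0 1 + C 0 1 * star (B 0 0) - C.trace * B 0 1)
        - B 0 1 * star (C 0 0 * B 0 0 + C 0 1 * star (B 0 1))).re) ?_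
    intro s
    rw [hXo]
    simp [fundamentalField, o, Matrix.trace_fin_two, hB0, hC0, hC1]
    ring
  have d2 : (derivAlong X (coord 2 Y)).1 o
      = -2 * (B 0 0).im * (C 0 1).re + ((C 0 0).im - (C 1 1).im) * (B 0 1).re := by
    have hf : ContDiff ℝ ∞ fun w : ℂ × ℂ =>
        (star w.1 * (fundamentalField C w).2 - w.2 * star (fundamentalField C w).1).im :=
      Complex.imCLM.contDiff.comp p1
    have e : (coord 2 Y).1 = fun y : H31 =>
        (star y.1.1 * (fundamentalField C y.1).2 - y.1.2 * star (fundamentalField C y.1).1).im := by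
      funext y
      rw [← hY]
      rfl
    rw [derivAlong_apply, e]
    refine dirD_o_of_expansion hf (X.2.2 o) (a := (C 0 1).im)
      (c := (star (B 0 0) * (C 0 0 * B 0 1 + C 0 1 * star (B 0 0) - C.trace * B 0 1)
        - B 0 1 * star (C 0 0 * B 0 0 + C 0 1 * star (B 0 1))).im) ?_
    intro s
    rw [hXo]
    simp [fundamentalField, o, Matrix.trace_fin_two, hB0, hC0, hC1]
    ring
  set κ := (lam + 2 * mu - t) / mu
  obtain ⟨h0, h1, h2⟩ := coord_sub_S12 lam mu t hlam hmu X Y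
  have x0 : (coord 0 X).1 o = (B 0 0).im := by
    change theta 0 o (X.1 o) = _
    rw [(theta_o _).1, hXo]
  have y1 : (coord 1 Y).1 o = (C 0 1).re := by
    change theta 1 o (Y.1 o) = _
    rw [(theta_o _).2.1, hYo]
  have y2 : (coord 2 Y).1 o = (C 0 1).im := by
    change theta 2 o (Y.1 o) = _
    rw [(theta_o _).2.2, hYo]
  set V := ((leviCivita lam mu).subTensor (S12 lam mu mu t)).cov X Y
  have v0 : theta 0 o (V.1 o) = 2 * (star (B 0 1) * C 0 1).im := by
    rw [← d0]
    exact congrArg (fun f : SmoothFn => f.1 o) h0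
  have v1 : theta 1 o (V.1 o) = 2 * (B 0 0).im * (C 0 1).im
      - ((C 0 0).im - (C 1 1).im) * (B 0 1).im - κ * ((B 0 0).im * (C 0 1).im) := by
    rw [← d1, ← x0, ← y2]
    exact congrArg (fun f : SmoothFn => f.1 o) h1
  have v2 : theta 2 o (V.1 o) = -2 * (B 0 0).im * (C 0 1).re
      + ((C 0 0).im - (C 1 1).im) * (B 0 1).re + κ * ((B 0 0).im * (C 0 1).re) := by
    rw [← d2, ← x0, ← y1]
    exact congrArg (fun f : SmoothFn => f.1 o) h2
  have vt := (mem_tangent_o _).mp (V.2.2 o)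
  rw [(theta_o _).1] at v0
  rw [(theta_o _).2.1] at v1
  rw [(theta_o _).2.2] at v2
  refine Prod.ext (Complex.ext ?_ ?_) (Complex.ext ?_ ?_)
  · rw [vt]
    simp [Matrix.mul_apply, Fin.sum_univ_two, hB2, hC2, hB0, hC0]
    ring
  · rw [v0]
    simp [Matrix.mul_apply, Fin.sum_univ_two, hB2, hC2, hB0, hC0]
    ring
  · rw [v1]
    simp [Matrix.mul_apply, Fin.sum_univ_two, hB0, hC0, hB1, hC1, htr]
    ring
  · rw [v2]
    simp [Matrix.mul_apply, Fin.sum_univ_two, hB0, hC0, hB1, hC1, htr]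
    ring

theorem isCanonicalConnection_U11 (lam mu t : ℝ) (hlam : lam ≠ 0) (hmu : mu ≠ 0) :
    IsCanonicalConnection U11 (mSpan lam mu t) hSpan
      ((leviCivita lam mu).subTensor (S12 lam mu mu t)) where
  invariant k X X' Y Y' hX hY := isPushforward_cov_U11 lam mu t hlam hmu k hX hY
  value := by
    intro B hB C hC P hP hBCP X Y hX hY
    obtain ⟨hBu, hBt⟩ := (mem_mSpan_iff lam mu t hmu B).mp hB
    have hCu := ((mem_mSpan_iff lam mu t hmu C).mp hC).1
    have hPu := ((mem_mSpan_iff lam mu t hmu P).mp hP).1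
    rw [cov_fundamentalField_o lam mu t hlam hmu hBu hCu hBt
      (fun z => by rw [hX, fundamental_U11 hBu]) (fun z => by rw [hY, fundamental_U11 hCu]),
      fundamental_U11 hPu, fundamentalField_o]
    obtain ⟨h0, h1, -, -⟩ := (mem_hSpan_iff _).mp hBCP
    rw [Matrix.sub_apply, sub_eq_zero] at h0 h1
    rw [h0, h1]

theorem isCanonicalConnection_SU11 (lam mu t : ℝ) (hlam : lam ≠ 0) (hmu : mu ≠ 0)
    (ht : t = lam + 2 * mu) :
    IsCanonicalConnection SU11 su11.toSubmodule ⊥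
      ((leviCivita lam mu).subTensor (S12 lam mu mu t)) where
  invariant k X X' Y Y' hX hY := by
    have e : ∀ {V V' : VF}, IsPushforward k V V' ↔ IsPushforward (inclU k) V V' := by
      intro V V'
      simp only [IsPushforward, inclU_smul]
    rw [e] at hX hY ⊢
    exact isPushforward_cov_U11 lam mu t hlam hmu (inclU k) hX hY
  value := by
    intro B hB C hC P hP hBCP X Y hX hY
    have hBt : (B 1 1).im = ((lam + 2 * mu - t) / mu - 1) * (B 0 0).im := by
      have h := congrArg Complex.im hB.2
      rw [Matrix.trace_fin_two] at h
      simp at h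
      rw [ht, sub_self, zero_div]
      linarith
    rw [cov_fundamentalField_o lam mu t hlam hmu hB.1 hC.1 hBt
      (fun z => by rw [hX, fundamental_SU11 hB]) (fun z => by rw [hY, fundamental_SU11 hC]),
      fundamental_SU11 hP, fundamentalField_o]
    rw [Submodule.mem_bot, sub_eq_zero] at hBCP
    rw [hBCP]

/-! ### The holonomy algebra and the reconstruction of the decomposition -/

/-- The rotation `X₁ ↦ X₂ ↦ -X₁`, `X₀ ↦ 0` of the tangent space at `o`. -/
def rotEnd : Module.End ℝ (tangent o) where
  toFun v := ⟨(0, Complex.I * v.1.2), by rw [mem_tangent_o]; rfl⟩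
  map_add' u v := by
    apply Subtype.ext
    simp [mul_add]
  map_smul' c v := by
    apply Subtype.ext
    simp [mul_left_comm]

theorem rotEnd_apply (v : tangent o) : (rotEnd v).1 = (0, Complex.I * v.1.2) := rfl

theorem rotEnd_ne_zero : rotEnd ≠ 0 := by
  intro h
  have h1 := congrArg (fun U : Module.End ℝ (tangent o) =>
    (U ⟨(0, 1), by rw [mem_tangent_o]; rfl⟩).1.2) h
  have h2 : Complex.I * 1 = 0 := h1
  simp at h2

theorem coord_ext_apply (a : Fin 3) (z : H31) (v : tangent z) :
    (coord a (ext z v)).1 z = theta a z v.1 :=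
  congrArg (fun u : tangent z => theta a z u.1) (ext_at z v)

theorem curvAt_sub_S12 (lam mu t : ℝ) (hlam : lam ≠ 0) (hmu : mu ≠ 0) (x y : tangent o) :
    ((leviCivita lam mu).subTensor (S12 lam mu mu t)).curvAt o x y
      = (2 * ((lam + 2 * mu - t) / mu) * (x.1.2.re * y.1.2.im - x.1.2.im * y.1.2.re)) • rotEnd := by
  ext1 v
  apply Subtype.ext
  set c := 2 * ((lam + 2 * mu - t) / mu) with hc
  set W := ((leviCivita lam mu).subTensor (S12 lam mu mu t)).curv (ext o x) (ext o y) (ext o v)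
    with hW
  obtain ⟨h0, h1, h2⟩ := coord_curv_sub_S12 lam mu t hlam hmu (ext o x) (ext o y) (ext o v)
  have e := fun a (u : tangent o) => coord_ext_apply a o u
  have w0 : theta 0 o (W.1 o) = 0 := congrArg (fun f : SmoothFn => f.1 o) h0
  have w1 : theta 1 o (W.1 o) = -c * ((theta 1 o x.1 * theta 2 o y.1
      - theta 2 o x.1 * theta 1 o y.1) * theta 2 o v.1) := by
    simp only [← e]
    exact congrArg (fun f : SmoothFn => f.1 o) h1
  have w2 : theta 2 o (W.1 o) = c * ((theta 1 o x.1 * theta 2 o y.1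
      - theta 2 o x.1 * theta 1 o y.1) * theta 1 o v.1) := by
    simp only [← e]
    exact congrArg (fun f : SmoothFn => f.1 o) h2
  change W.1 o = (c * (x.1.2.re * y.1.2.im - x.1.2.im * y.1.2.re)) • (rotEnd v).1
  have wt := (mem_tangent_o _).mp (W.2.2 o)
  simp only [theta_o] at w0 w1 w2
  rw [rotEnd_apply]
  refine Prod.ext (Complex.ext ?_ ?_) (Complex.ext ?_ ?_)
  · simpa using wt
  · simpa using w0
  · rw [w1]
    simp
    ring
  · rw [w2]
    simp
    ring

theorem tensorAt_S12_sub (lam mu t : ℝ) (hlam : lam ≠ 0) (x y : tangent o) :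
    (tensorAt (S12 lam mu mu t) o x y - tensorAt (S12 lam mu mu t) o y x).1
      = (((2 * (x.1.2.im * y.1.2.re - x.1.2.re * y.1.2.im) : ℝ) : ℂ) * Complex.I,
        (((t - lam) / mu : ℝ) : ℂ) * Complex.I
          * ((x.1.1.im : ℂ) * y.1.2 - (y.1.1.im : ℂ) * x.1.2)) := by
  have key : ∀ x y : tangent o, ∀ W : VF, W = (S12 lam mu mu t).app (ext o x) (ext o y) →
      (W.1 o).1.re = 0 ∧
      (W.1 o).1.im = x.1.2.im * y.1.2.re - x.1.2.re * y.1.2.im ∧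
      (W.1 o).2.re = -(lam / mu * (x.1.2.im * y.1.1.im)) - t / mu * (x.1.1.im * y.1.2.im) ∧
      (W.1 o).2.im = t / mu * (x.1.1.im * y.1.2.re) + lam / mu * (x.1.2.re * y.1.1.im) := by
    intro x y W hW
    obtain ⟨h0, h1, h2⟩ := coord_S12 lam mu t hlam (ext o x) (ext o y)
    rw [← hW] at h0 h1 h2
    have e := fun a (u : tangent o) => coord_ext_apply a o u
    have w0 : theta 0 o (W.1 o) = theta 2 o x.1 * theta 1 o y.1
        - theta 1 o x.1 * theta 2 o y.1 := by
      simp only [← e]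
      exact congrArg (fun f : SmoothFn => f.1 o) h0
    have w1 : theta 1 o (W.1 o) = -(lam / mu * (theta 2 o x.1 * theta 0 o y.1))
        - t / mu * (theta 0 o x.1 * theta 2 o y.1) := by
      simp only [← e]
      exact congrArg (fun f : SmoothFn => f.1 o) h1
    have w2 : theta 2 o (W.1 o) = t / mu * (theta 0 o x.1 * theta 1 o y.1)
        + lam / mu * (theta 1 o x.1 * theta 0 o y.1) := by
      simp only [← e]
      exact congrArg (fun f : SmoothFn => f.1 o) h2
    simp only [theta_o] at w0 w1 w2
    exact ⟨(mem_tangent_o _).mp (W.2.2 o), w0, w1, w2⟩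
  obtain ⟨a0, a1, a2, a3⟩ := key x y _ rfl
  obtain ⟨b0, b1, b2, b3⟩ := key y x _ rfl
  change ((S12 lam mu mu t).app (ext o x) (ext o y)).1 o
    - ((S12 lam mu mu t).app (ext o y) (ext o x)).1 o = _
  refine Prod.ext (Complex.ext ?_ ?_) (Complex.ext ?_ ?_)
  · simp [a0, b0]
  · simp [a1, b1]
    ring
  · simp [a2, b2]
    ring
  · simp [a3, b3]
    ring

theorem holonomyAlgebra_sub_S12 (lam mu t : ℝ) (hlam : lam ≠ 0) (hmu : mu ≠ 0)
    (ht : t ≠ lam + 2 * mu) :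
    (((leviCivita lam mu).subTensor (S12 lam mu mu t)).holonomyAlgebra o).toSubmodule
      = Submodule.span ℝ {rotEnd} := by
  set D := (leviCivita lam mu).subTensor (S12 lam mu mu t) with hD
  apply le_antisymm
  · -- The line spanned by the rotation is an abelian Lie subalgebra.
    let K : LieSubalgebra ℝ (Module.End ℝ (tangent o)) :=
      { Submodule.span ℝ {rotEnd} with
        lie_mem' := by
          intro U V hU hV
          obtain ⟨a, rfl⟩ := Submodule.mem_span_singleton.mp hU
          obtain ⟨b, rfl⟩ := Submodule.mem_span_singleton.mp hV
          change (a • rotEnd) * (b • rotEnd) - (b • rotEnd) * (a • rotEnd) ∈ _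
          rw [smul_mul_smul_comm, smul_mul_smul_comm, mul_comm a b, sub_self]
          exact Submodule.zero_mem _ }
    have h : D.holonomyAlgebra o ≤ K := by
      refine LieSubalgebra.lieSpan_le.mpr ?_
      rintro _ ⟨x, y, rfl⟩
      change D.curvAt o x y ∈ Submodule.span ℝ {rotEnd}
      rw [hD, curvAt_sub_S12 lam mu t hlam hmu]
      exact Submodule.smul_mem _ _ (Submodule.mem_span_singleton_self _)
    exact h
  · rw [Submodule.span_singleton_le_iff_mem]
    have hk : 2 * ((lam + 2 * mu - t) / mu) ≠ 0 :=
      mul_ne_zero two_ne_zero (div_ne_zero (sub_ne_zero.mpr ht.symm) hmu)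
    let x : tangent o := ⟨(0, 1), by rw [mem_tangent_o]; rfl⟩
    let y : tangent o := ⟨(0, Complex.I), by rw [mem_tangent_o]; rfl⟩
    have h1 : D.curvAt o x y = (2 * ((lam + 2 * mu - t) / mu)) • rotEnd := by
      rw [hD, curvAt_sub_S12 lam mu t hlam hmu]
      simp [x, y]
    have h2 : D.curvAt o x y ∈ D.holonomyAlgebra o := LieSubalgebra.subset_lieSpan ⟨x, y, rfl⟩
    have h3 := (D.holonomyAlgebra o).smul_mem (2 * ((lam + 2 * mu - t) / mu))⁻¹ h2
    rw [h1, smul_smul, inv_mul_cancel₀ hk, one_smul] at h3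
    exact h3

theorem holonomyAlgebra_sub_S12_of_eq (lam mu t : ℝ) (hlam : lam ≠ 0) (hmu : mu ≠ 0)
    (ht : t = lam + 2 * mu) :
    (((leviCivita lam mu).subTensor (S12 lam mu mu t)).holonomyAlgebra o).toSubmodule = ⊥ := by
  rw [eq_bot_iff]
  have h : ((leviCivita lam mu).subTensor (S12 lam mu mu t)).holonomyAlgebra o ≤ ⊥ := by
    refine LieSubalgebra.lieSpan_le.mpr ?_
    rintro _ ⟨x, y, rfl⟩
    rw [curvAt_sub_S12 lam mu t hlam hmu, ht, sub_self]
    simp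
  exact h

/-- The value at `o` of the fundamental field of `B ∈ u(1,1)`. -/
def evalO : u11 →ₗ[ℝ] tangent o where
  toFun B := ⟨(B.1 0 0, B.1 0 1), by rw [mem_tangent_o]; exact ((mem_u11_iff B.1).mp B.2).1⟩
  map_add' _ _ := rfl
  map_smul' _ _ := rfl

/-- The coefficient of `diag(0, i)` in the decomposition of `B ∈ u(1,1)`, when the
complement of the line of `diag(0, i)` is given by `tr B = κ B₀₀`. -/
def hCoeff (κ : ℝ) : u11 →ₗ[ℝ] ℝ where
  toFun B := (B.1 1 1).im - (κ - 1) * (B.1 0 0).im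
  map_add' B C := by
    simp
    ring
  map_smul' c B := by
    simp
    ring

theorem evalO_apply (B : u11) : (evalO B).1 = (B.1 0 0, B.1 0 1) := rfl

theorem hCoeff_apply (κ : ℝ) (B : u11) :
    hCoeff κ B = (B.1 1 1).im - (κ - 1) * (B.1 0 0).im := rfl

theorem eq_zero_of_evalO_of_hCoeff {κ : ℝ} {B : u11} (h1 : evalO B = 0) (h2 : hCoeff κ B = 0) :
    B = 0 := by
  obtain ⟨-, hB1, hB2⟩ := (mem_u11_iff B.1).mp B.2
  have h := congrArg Subtype.val h1
  rw [evalO_apply] at h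
  have e0 : B.1 0 0 = 0 := congrArg Prod.fst h
  have e1 : B.1 0 1 = 0 := congrArg Prod.snd h
  rw [hCoeff_apply, e0, Complex.zero_im, mul_zero, sub_zero] at h2
  apply Subtype.ext
  ext i j
  fin_cases i <;> fin_cases j <;> simp [hB2, e0, e1]
  exact Complex.ext hB1 h2

/-- The isomorphism of `u(1,1)` onto its model: evaluation at `o` together with the infinitesimal
isotropy representation, which sends `diag(0, i)` to minus the rotation `rotEnd`, because
`[diag(0, i), X] = -[X₀, X]/2`. -/
def modelMap (κ : ℝ) : u11 →ₗ[ℝ] Module.End ℝ (tangent o) × tangent o :=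
  ((-hCoeff κ).smulRight rotEnd).prod evalO

theorem modelMap_apply (κ : ℝ) (B : u11) : modelMap κ B = ((-hCoeff κ B) • rotEnd, evalO B) := rfl

theorem hCoeff_lie (κ : ℝ) (B C : u11) : hCoeff κ ⁅B, C⁆
    = 2 * κ * ((B.1 0 1).re * (C.1 0 1).im - (B.1 0 1).im * (C.1 0 1).re) := by
  obtain ⟨hB0, hB1, hB2⟩ := (mem_u11_iff B.1).mp B.2
  obtain ⟨hC0, hC1, hC2⟩ := (mem_u11_iff C.1).mp C.2
  change ((B.1 * C.1 - C.1 * B.1) 1 1).im - (κ - 1) * ((B.1 * C.1 - C.1 * B.1) 0 0).im = _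
  simp [Matrix.mul_apply, Fin.sum_univ_two, hB0, hB1, hC0, hC1, hB2, hC2]
  ring

theorem modelMap_lie (lam mu t : ℝ) (hlam : lam ≠ 0) (hmu : mu ≠ 0) (B C : u11) :
    modelMap ((lam + 2 * mu - t) / mu) ⁅B, C⁆
      = modelBracket ((leviCivita lam mu).subTensor (S12 lam mu mu t)) (S12 lam mu mu t) o
        (modelMap ((lam + 2 * mu - t) / mu) B) (modelMap ((lam + 2 * mu - t) / mu) C) := by
  obtain ⟨hB0, hB1, hB2⟩ := (mem_u11_iff B.1).mp B.2
  obtain ⟨hC0, hC1, hC2⟩ := (mem_u11_iff C.1).mp C.2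
  set κ := (lam + 2 * mu - t) / mu with hκ
  have hk : (t - lam) / mu = 2 - κ := by
    rw [hκ]
    field_simp
    ring
  simp only [modelMap_apply, modelBracket]
  refine Prod.ext ?_ ?_
  · change (-hCoeff κ ⁅B, C⁆) • rotEnd = (-hCoeff κ B) • rotEnd * (-hCoeff κ C) • rotEnd
      - (-hCoeff κ C) • rotEnd * (-hCoeff κ B) • rotEnd
      - ((leviCivita lam mu).subTensor (S12 lam mu mu t)).curvAt o (evalO B) (evalO C)
    rw [smul_mul_smul_comm, smul_mul_smul_comm, mul_comm (-hCoeff κ B), sub_self, zero_sub,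
      curvAt_sub_S12 lam mu t hlam hmu, hCoeff_lie, neg_smul]
    rfl
  · have hT := tensorAt_S12_sub lam mu t hlam (evalO B) (evalO C)
    rw [hk] at hT
    apply Subtype.ext
    rw [add_sub_assoc]
    change ((B.1 * C.1 - C.1 * B.1) 0 0, (B.1 * C.1 - C.1 * B.1) 0 1)
      = ((-hCoeff κ B) • (rotEnd (evalO C)).1 - (-hCoeff κ C) • (rotEnd (evalO B)).1)
        + (tensorAt (S12 lam mu mu t) o (evalO B) (evalO C)
          - tensorAt (S12 lam mu mu t) o (evalO C) (evalO B)).1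
    rw [hT, rotEnd_apply, rotEnd_apply, evalO_apply, evalO_apply, hCoeff_apply, hCoeff_apply]
    refine Prod.ext (Complex.ext ?_ ?_) (Complex.ext ?_ ?_) <;>
    · simp [Matrix.mul_apply, Fin.sum_univ_two, hB0, hB1, hC0, hC1, hB2, hC2]
      try ring

theorem isConstructedFrom_U11 (lam mu t : ℝ) (hlam : lam ≠ 0) (hmu : mu ≠ 0)
    (ht : t ≠ lam + 2 * mu) :
    IsConstructedFrom U11 u11 (mSpan lam mu t) hSpan
      ((leviCivita lam mu).subTensor (S12 lam mu mu t)) (S12 lam mu mu t) := by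
  set κ := (lam + 2 * mu - t) / mu with hκ
  refine ⟨modelMap κ, ?_, ?_, modelMap_lie lam mu t hlam hmu, ?_, ?_, ?_⟩
  · rw [← LinearMap.ker_eq_bot, eq_bot_iff]
    intro B hB
    have h : ((-hCoeff κ B) • rotEnd, evalO B) = 0 := hB
    have h1 : (-hCoeff κ B) • rotEnd = 0 := congrArg Prod.fst h
    have h2 : evalO B = 0 := congrArg Prod.snd h
    have h3 := (smul_eq_zero.mp h1).resolve_right rotEnd_ne_zero
    exact eq_zero_of_evalO_of_hCoeff h2 (neg_eq_zero.mp h3)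
  · rw [holonomyAlgebra_sub_S12 lam mu t hlam hmu ht]
    apply le_antisymm
    · rintro _ ⟨B, rfl⟩
      exact ⟨Submodule.smul_mem _ _ (Submodule.mem_span_singleton_self _), trivial⟩
    · rintro ⟨U, x⟩ ⟨hU, -⟩
      obtain ⟨c, hc⟩ := Submodule.mem_span_singleton.mp hU
      have hx := (mem_tangent_o _).mp x.2
      refine ⟨⟨!![x.1.1, x.1.2; star x.1.2, ((-c + (κ - 1) * x.1.1.im : ℝ) : ℂ) * Complex.I], ?_⟩,
        ?_⟩
      · rw [mem_u11_iff]
        exact ⟨hx, by simp, rfl⟩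
      · rw [modelMap_apply, hCoeff_apply]
        refine Prod.ext ?_ rfl
        refine Eq.trans ?_ hc
        change (_ : ℝ) • rotEnd = c • rotEnd
        congr 1
        simp
  · intro B
    rw [mem_hSpan_iff]
    obtain ⟨hB0, hB1, hB2⟩ := (mem_u11_iff B.1).mp B.2
    change _ ↔ evalO B = 0
    rw [Subtype.ext_iff, evalO_apply]
    constructor
    · rintro ⟨h0, h1, -, -⟩
      rw [h0, h1]
      rfl
    · intro h
      have e0 : B.1 0 0 = 0 := congrArg Prod.fst h
      have e1 : B.1 0 1 = 0 := congrArg Prod.snd h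
      exact ⟨e0, e1, by rw [hB2, e1, star_zero], hB1⟩
  · intro B
    rw [mem_mSpan_iff lam mu t hmu, ← hκ]
    change _ ↔ (-hCoeff κ B) • rotEnd = 0
    rw [smul_eq_zero, or_iff_left rotEnd_ne_zero, neg_eq_zero, hCoeff_apply, sub_eq_zero]
    exact and_iff_right B.2
  · intro B hB
    rw [fundamental_U11 B.2, fundamentalField_o]
    rfl

theorem isConstructedFrom_SU11 (lam mu t : ℝ) (hlam : lam ≠ 0) (hmu : mu ≠ 0)
    (ht : t = lam + 2 * mu) :
    IsConstructedFrom SU11 su11 su11.toSubmodule ⊥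
      ((leviCivita lam mu).subTensor (S12 lam mu mu t)) (S12 lam mu mu t) := by
  have hκ : (lam + 2 * mu - t) / mu = 0 := by rw [ht, sub_self, zero_div]
  let ι : su11 →ₗ[ℝ] u11 :=
    Submodule.inclusion (fun B hB => hB.1 : su11.toSubmodule ≤ u11.toSubmodule)
  have hc : ∀ B : su11, hCoeff 0 (ι B) = 0 := by
    intro B
    have h := congrArg Complex.im B.2.2
    rw [Matrix.trace_fin_two] at h
    simp at h
    change (B.1 1 1).im - (0 - 1) * (B.1 0 0).im = 0
    linarith
  have hm1 : ∀ B : su11, (modelMap 0 (ι B)).1 = 0 := by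
    intro B
    rw [modelMap_apply, hc, neg_zero, zero_smul]
  have hinj : ∀ B : su11, evalO (ι B) = 0 → B = 0 := by
    intro B hB
    have := eq_zero_of_evalO_of_hCoeff hB (hc B)
    exact Subtype.ext (congrArg (fun C : u11 => C.1) this)
  refine ⟨(modelMap 0).comp ι, ?_, ?_, ?_, ?_, ?_, ?_⟩
  · rw [← LinearMap.ker_eq_bot, eq_bot_iff]
    intro B hB
    exact hinj B (congrArg Prod.snd (hB : modelMap 0 (ι B) = 0))
  · rw [holonomyAlgebra_sub_S12_of_eq lam mu t hlam hmu ht]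
    apply le_antisymm
    · rintro _ ⟨B, rfl⟩
      exact ⟨(Submodule.mem_bot ℝ).mpr (hm1 B), trivial⟩
    · rintro ⟨U, x⟩ ⟨hU, -⟩
      have hU' : U = 0 := (Submodule.mem_bot ℝ).mp hU
      have hx := (mem_tangent_o _).mp x.2
      have hmem : !![x.1.1, x.1.2; star x.1.2, -x.1.1] ∈ su11 := by
        refine ⟨(mem_u11_iff _).mpr ⟨hx, ?_, rfl⟩, ?_⟩
        · simpa using hx
        · simp [Matrix.trace_fin_two]
      refine ⟨⟨_, hmem⟩, ?_⟩
      rw [hU']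
      exact Prod.ext (hm1 _) rfl
  · intro B C
    have h := modelMap_lie lam mu t hlam hmu (ι B) (ι C)
    rw [hκ] at h
    exact h
  · intro B
    rw [Submodule.mem_bot]
    constructor
    · intro h
      have : B = 0 := Subtype.ext h
      rw [this, map_zero]
      rfl
    · intro h
      exact congrArg Subtype.val (hinj B h)
  · intro B
    exact ⟨fun _ => hm1 B, fun _ => B.2⟩
  · intro B hB
    rw [fundamental_SU11 B.2, fundamentalField_o]
    rfl

end AdS
end

theorem mainTheorem3 (lam mu nu t : ℝ) (hlam : lam ≠ 0) (hmu : 0 < mu) (hnu : 0 < nu)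
    (hne : -lam ≠ mu) (heq : mu = nu) :
    ∃ D : AdS.Connection, D.IsLeviCivita lam mu nu ∧
      AdS.IsHomogeneousStructure lam mu nu D (AdS.S12 lam mu nu t) ∧
      (t ≠ lam + 2 * mu →
        ((∀ (A : AdS.SU11) (w : Circle) (z : AdS.H31),
            AdS.toMat ((A, w) • z).1 = A.1.1 * AdS.toMat z.1 * !![(w : ℂ)⁻¹, 0; 0, (w : ℂ)]) ∧
          AdS.ActsByIsometries lam mu nu (AdS.SU11 × Circle) ∧
          MulAction.IsPretransitive (AdS.SU11 × Circle) AdS.H31 ∧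
          AdS.AlmostEffective (AdS.SU11 × Circle)) ∧
        (Function.Surjective AdS.psi ∧
          (∀ (p : AdS.SU11 × Circle) (z : AdS.H31), AdS.psi p • z = p • z) ∧
          (∀ (u : AdS.U11) (z : AdS.H31),
            AdS.toMat (u • z).1 = u.1.1 * AdS.toMat z.1 * !![1, 0; 0, (u.1.1.det)⁻¹]) ∧
          AdS.ActsByIsometries lam mu nu AdS.U11 ∧
          MulAction.IsPretransitive AdS.U11 AdS.H31 ∧
          FaithfulSMul AdS.U11 AdS.H31) ∧
        Module.finrank ℝ AdS.hSpan = 1 ∧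
        AdS.IsInducedDecomposition AdS.U11 AdS.u11 (AdS.mSpan lam mu t) AdS.hSpan D
          (AdS.S12 lam mu nu t)) ∧
      (t = lam + 2 * mu →
        ((∀ (A : AdS.SU11) (z : AdS.H31), AdS.toMat (A • z).1 = A.1.1 * AdS.toMat z.1) ∧
          AdS.ActsByIsometries lam mu nu AdS.SU11 ∧
          MulAction.IsPretransitive AdS.SU11 AdS.H31 ∧
          FaithfulSMul AdS.SU11 AdS.H31) ∧
        AdS.IsInducedDecomposition AdS.SU11 AdS.su11 AdS.su11.toSubmodule ⊥ D
          (AdS.S12 lam mu nu t)) := by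
  subst heq
  have hmu0 : mu ≠ 0 := hmu.ne'
  refine ⟨AdS.leviCivita lam mu, AdS.leviCivita_isLeviCivita lam mu hlam hmu0,
    AdS.isHomogeneousStructure_S12 lam mu t hlam hmu0, fun ht => ⟨?_, ?_, ?_, ?_⟩,
    fun ht => ⟨?_, ?_⟩⟩
  · exact ⟨AdS.toMat_smul_prod,
      AdS.actsByIsometries_of_hom lam mu AdS.psi AdS.continuous_psi AdS.psi_smul,
      AdS.isPretransitive_prod, AdS.almostEffective_prod⟩
  · exact ⟨AdS.psi_surjective, AdS.psi_smul, AdS.toMat_smul_U11,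
      AdS.actsByIsometries_U11 lam mu, AdS.isPretransitive_U11, AdS.faithfulSMul_U11⟩
  · refine finrank_span_singleton fun h => ?_
    simpa using congrFun (congrFun h 1) 1
  · exact ⟨AdS.isReductiveDecomposition_U11 lam mu t hmu0,
      AdS.isCanonicalConnection_U11 lam mu t hlam hmu0,
      AdS.isConstructedFrom_U11 lam mu t hlam hmu0 ht⟩
  · exact ⟨AdS.toMat_smul_SU11,
      AdS.actsByIsometries_of_hom lam mu AdS.inclU AdS.continuous_inclU AdS.inclU_smul,
      AdS.isPretransitive_SU11, AdS.faithfulSMul_SU11⟩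
  · exact ⟨AdS.isReductiveDecomposition_SU11,
      AdS.isCanonicalConnection_SU11 lam mu t hlam hmu0 ht,
      AdS.isConstructedFrom_SU11 lam mu t hlam hmu0 ht⟩
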